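/- In the Congested Clique model, $n$ synchronous nodes, identified with $0,\dots,n-1$ and all knowing $n$, communicate in rounds: in every round each node sends to every other node a (possibly different) message of $O(\log n)$ bits, and then performs unlimited local computation. The input is a simple graph $G$ on the $n$ nodes; initially each node knows its own identifier and the set of its neighbours in $G$. The girth $g$ of $G$ is the length of its shortest cycle, with $g=\infty$ if $G$ has no cycle. There is a deterministic algorithm in the Congested Clique model which, on every triangle-free graph $G$ on $n$ nodes, whose girth $g$ is not known in advance, terminates within $\tilde O(n^{1/10})$ rounds with every node having output the exact girth $g$. Here $\tilde O(n^{1/10})$ means $O(n^{1/10}(\log n)^{k})$ for some constant $k$, uniformly over all triangle-free graphs on $n$ nodes. -/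

import Mathlib

open Filter Asymptotics

namespace CongestedClique

/-- A message of at most `B` bits (the empty string means that nothing is said). -/
abbrev Message (B : ℕ) : Type := {l : List Bool // l.length ≤ B}

/-- A deterministic synchronous message-passing algorithm for a clique of `n` nodes, the nodes
being identified with their identifiers `0, …, n - 1`, with a bandwidth of `B` bits per ordered
pair of nodes and round, and with outputs in `Out`. Local computation and local memory are
unlimited, so the local rules are arbitrary functions and the local states form an arbitrary
type. -/
structure Algorithm (n B : ℕ) (Out : Type) where
  /-- The local states of a node. -/
  State : Type
  /-- The state in which a node starts, given its own identifier and the set of its neighbours in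
  the input graph. -/
  init : Fin n → Set (Fin n) → State
  /-- The message that a node in the given state sends to each node in the next round. -/
  send : State → Fin n → Message B
  /-- The new state of a node, from its old state and the messages it gets from all nodes. -/
  receive : State → (Fin n → Message B) → State
  /-- The output of a node in the given state, if it has decided on one. -/
  output : State → Option Out

namespace Algorithm

variable {n B : ℕ} {Out : Type}

/-- The state of node `v` after `t` rounds of the algorithm on the input graph `G`. -/
def stateAfter (A : Algorithm n B Out) (G : SimpleGraph (Fin n)) : ℕ → Fin n → A.State
  | 0, v => A.init v (G.neighborSet v)
  | t + 1, v => A.receive (A.stateAfter G t v) (fun u => A.send (A.stateAfter G t u) v)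

/-- On the input graph `G`, node `v` decides after exactly `t` rounds, and its output is `y`. -/
def DecidesAt (A : Algorithm n B Out) (G : SimpleGraph (Fin n)) (v : Fin n) (t : ℕ) (y : Out) :
    Prop :=
  A.output (A.stateAfter G t v) = some y ∧ ∀ s < t, A.output (A.stateAfter G s v) = none

/-- On the input graph `G`, every node decides within `T` rounds, and every node outputs `y`. -/
def OutputsWithin (A : Algorithm n B Out) (G : SimpleGraph (Fin n)) (T : ℕ) (y : Out) : Prop :=
  ∀ v : Fin n, ∃ t ≤ T, A.DecidesAt G v t y

end Algorithm

/-- `T n = Õ(f n)`: for some fixed `k`, `T n = O(f n * (log n) ^ k)` as `n` tends to infinity. -/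
def IsSoftO (T : ℕ → ℕ) (f : ℕ → ℝ) : Prop :=
  ∃ k : ℕ, (fun n => (T n : ℝ)) =O[atTop] (fun n => f n * Real.log (n : ℝ) ^ k)

end CongestedClique

/-! For each `p = 4, …, 20` in turn, assume the girth is at least `p` and decide whether it equals
`p`. Let `Q` be a prime of order `n ^ (1/p)`, let `m` be the degree sum, and let `ℓ` be `n ^ (1/10)`
rounded up. If `m > 4 Q² n ℓ`, the Moore bound `sum_degree_le_of_egirth` gives a cycle of length at
most `p`, so the girth is `p` without further communication. Once the girth is known to be at least
21, the same bound gives `m = O(n ℓ)`, and the whole graph can be broadcast in `O(ℓ)` rounds.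

In the remaining case `m ≤ 4 Q² n ℓ`, hash the vertices into `Q` classes and cut the edges between
each ordered pair of classes into chunks of at most `s = 5 n ℓ` edges. Every `p`-cycle lies in the
union of a closed list of `p` chunks, consecutive ones meeting in a class. The number of such lists
is at most the trace of the `p`-th power of the matrix of chunk counts, hence at most the `p`-th
power of its Frobenius norm (`trace_pow_le`). With a good hash function that norm is at most `3 Q`
(`sum_sq_chunks_le`), so there are `O(n)` lists. Each node receives `O(1)` lists, that is `O(n ℓ)`
edges, which takes `O(ℓ)` rounds, and looks for a cycle in each.

The norm bound needs classes of balanced total degree, which every member of the family in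
`exists_hash_family` has, and few colliding pairs of neighbours, which holds on average over the
family. The family has `O(n)` members, so the nodes evaluate all of them and agree on one at least
as good as average (`Solves.choose_hash`); this removes the randomness.

Protocols are treated through knowledge: `Solves` speaks only of which inputs a node cannot tell
apart, and `Solves.exists_algorithm` turns this into an actual algorithm. -/

namespace CongestedClique

/-! ### Bounded fibers, load balancing and relays -/

/-- `FiberBound f L` says that every fiber of `f` has at most `L` elements. -/
def FiberBound {ι A : Type*} (f : ι → A) (L : ℕ) : Prop :=
  ∃ idx : ι → Fin L, Function.Injective fun e => (f e, idx e)

namespace FiberBound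

variable {ι ι' A A' : Type*} {f : ι → A} {L : ℕ}

theorem of_fintype {J : Type*} [Fintype J] (hJ : Fintype.card J ≤ L) (idx : ι → J)
    (h : Function.Injective fun e => (f e, idx e)) : FiberBound f L := by
  refine ⟨fun e => Fin.castLE hJ (Fintype.equivFin J (idx e)), fun e e' hee => h ?_⟩
  simp only [Prod.mk.injEq] at hee ⊢
  refine ⟨hee.1, (Fintype.equivFin J).injective (Fin.castLE_injective hJ hee.2)⟩

theorem comp_injective (h : FiberBound f L) {φ : ι' → ι} (hφ : Function.Injective φ) :
    FiberBound (f ∘ φ) L := by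
  obtain ⟨idx, hi⟩ := h
  exact ⟨idx ∘ φ, fun e e' hee => hφ (hi hee)⟩

theorem of_factor (h : FiberBound f L) {f' : ι → A'} (g : A' → A) (hg : ∀ e, g (f' e) = f e) :
    FiberBound f' L := by
  obtain ⟨idx, hi⟩ := h
  refine ⟨idx, fun e e' hee => hi ?_⟩
  simp only [Prod.mk.injEq] at hee ⊢
  exact ⟨by rw [← hg e, ← hg e', hee.1], hee.2⟩

theorem of_card [Fintype ι] (h : Fintype.card ι ≤ L) : FiberBound f L :=
  of_fintype h id fun _ _ hee => (Prod.ext_iff.1 hee).2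

theorem comp_right (h : FiberBound f L) {g : A → A'} (hg : Function.Injective g) :
    FiberBound (g ∘ f) L := by
  obtain ⟨idx, hi⟩ := h
  refine ⟨idx, fun e e' hee => hi ?_⟩
  simp only [Prod.mk.injEq, Function.comp] at hee ⊢
  exact ⟨hg hee.1, hee.2⟩

theorem card_filter_le [Fintype ι] (h : FiberBound f L) (a : A) (s : Finset ι)
    (hs : ∀ e ∈ s, f e = a) : s.card ≤ L := by
  obtain ⟨idx, hi⟩ := h
  have : Set.InjOn idx s := fun e he e' he' hee => hi (by
    simp only [Prod.mk.injEq]; exact ⟨(hs e he).trans (hs e' he').symm, hee⟩)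
  simpa using Finset.card_le_card_of_injOn (t := Finset.univ) idx (fun _ _ => Finset.mem_univ _) this

end FiberBound

theorem exists_fiberBound {ι A : Type*} [Fintype ι] [Fintype A] {L : ℕ}
    (h : Fintype.card ι ≤ Fintype.card A * L) : ∃ f : ι → A, FiberBound f L := by
  obtain ⟨φ⟩ : Nonempty (ι ↪ A × Fin L) :=
    Function.Embedding.nonempty_of_card_le (by simpa using h)
  exact ⟨fun e => (φ e).1, fun e => (φ e).2, φ.injective⟩

/-- Greedy edge colouring of a bipartite multigraph, used to route through intermediate nodes. -/
theorem exists_relay {ι A A' C : Type*} [Fintype ι] [Fintype C] {f : ι → A} {g : ι → A'}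
    {a b L : ℕ} (hf : FiberBound f a) (hg : FiberBound g b) (h : a + b ≤ Fintype.card C * L) :
    ∃ ρ : ι → C, FiberBound (fun e => (f e, ρ e)) L ∧ FiberBound (fun e => (g e, ρ e)) L := by
  classical
  rcases isEmpty_or_nonempty ι with hι | ⟨⟨e₀⟩⟩
  · exact ⟨isEmptyElim, ⟨isEmptyElim, fun e => isEmptyElim e⟩, ⟨isEmptyElim, fun e => isEmptyElim e⟩⟩
  have hpos : 0 < a := by
    obtain ⟨idx, -⟩ := hf
    exact (Nat.zero_le _).trans_lt (idx e₀).2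
  have key : ∀ s : Finset ι, ∃ c : ι → C × Fin L, ∀ e ∈ s, ∀ e' ∈ s, e ≠ e' →
      (f e = f e' ∨ g e = g e') → c e ≠ c e' := by
    intro s
    induction s using Finset.induction_on with
    | empty =>
      have : 0 < Fintype.card (C × Fin L) := by
        rw [Fintype.card_prod, Fintype.card_fin]
        omega
      obtain ⟨x⟩ := Fintype.card_pos_iff.1 this
      exact ⟨fun _ => x, by simp⟩
    | insert x s hx ih =>
      obtain ⟨c, hc⟩ := ih
      set N := s.filter (fun e => f e = f x ∨ g e = g x) with hN
      have h1 : (insert x (s.filter fun e => f e = f x)).card ≤ a :=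
        hf.card_filter_le (f x) _ (by simp)
      have h2 : (s.filter fun e => g e = g x).card ≤ b :=
        hg.card_filter_le (g x) _ (by simp)
      rw [Finset.card_insert_of_notMem (by simp [hx])] at h1
      -- A colour is a relay together with a slot. Since `x` itself takes one of the `a` places in
      -- its `f`-fiber, at most `a - 1 + b` colours are forbidden.
      have h3 : (N.image c).card < Fintype.card (C × Fin L) := by
        have : N.card ≤ (s.filter fun e => f e = f x).card + (s.filter fun e => g e = g x).card := by
          rw [hN, Finset.filter_or]
          exact Finset.card_union_le _ _
        have h4 := Finset.card_image_le (s := N) (f := c)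
        simp only [Fintype.card_prod, Fintype.card_fin]
        omega
      obtain ⟨y, hy⟩ : ∃ y, y ∉ N.image c := by
        by_contra! hcon
        rw [Finset.eq_univ_of_forall hcon] at h3
        simp at h3
      have hy' : ∀ e ∈ s, f e = f x ∨ g e = g x → c e ≠ y := fun e he hfe hce =>
        hy (Finset.mem_image.2 ⟨e, by simp [hN, he, hfe], hce⟩)
      refine ⟨Function.update c x y, fun e he e' he' hee hfg => ?_⟩
      rcases Finset.mem_insert.1 he with rfl | hes
      · rcases Finset.mem_insert.1 he' with rfl | he'
        · exact absurd rfl hee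
        · rw [Function.update_self, Function.update_of_ne (Ne.symm hee)]
          exact (hy' e' he' (hfg.imp Eq.symm Eq.symm)).symm
      · rcases Finset.mem_insert.1 he' with rfl | he''
        · rw [Function.update_self, Function.update_of_ne hee]
          exact hy' e hes hfg
        · have h1 : e ≠ x := fun h => hx (h ▸ hes)
          have h2 : e' ≠ x := fun h => hx (h ▸ he'')
          rw [Function.update_of_ne h1, Function.update_of_ne h2]
          exact hc e hes e' he'' hee hfg
  obtain ⟨c, hc⟩ := key Finset.univ
  refine ⟨fun e => (c e).1, ⟨fun e => (c e).2, fun e e' hee => ?_⟩,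
    ⟨fun e => (c e).2, fun e e' hee => ?_⟩⟩ <;>
  · simp only [Prod.mk.injEq] at hee
    by_contra hne
    refine hc e (Finset.mem_univ _) e' (Finset.mem_univ _) hne ?_ (Prod.ext hee.1.2 hee.2)
    tauto

/-! ### Protocols as refinement of knowledge -/

section Knowledge

variable {n B : ℕ} {I Out : Type}

/-- `Solves B X r S K`: if the input is known to lie in `S`, and if `K v i j` expresses that node
`v` cannot distinguish the inputs `i` and `j`, then `r` further rounds with a bandwidth of `B` bits
suffice for every node to learn the value of `X` at the input. -/
def Solves (B : ℕ) (X : I → Out) : ℕ → Set I → (Fin n → I → I → Prop) → Prop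
  | 0, S, K => ∀ v, ∀ i ∈ S, ∀ j ∈ S, K v i j → X i = X j
  | r + 1, S, K => ∃ M : I → Fin n → Fin n → Message B,
      (∀ u, ∀ i ∈ S, ∀ j ∈ S, K u i j → M i u = M j u) ∧
        Solves B X r S fun v i j => K v i j ∧ ∀ u, M i u v = M j u v

variable {X : I → Out}

/-- If all nodes know the value of `P`, then it suffices to solve the problem separately for each
value of `P`. -/
theorem Solves.of_forall_fiber {κ : Type*} (P : I → κ) {r : ℕ} {S : Set I}
    {K : Fin n → I → I → Prop} {K' : κ → Fin n → I → I → Prop}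
    (h : ∀ c, Solves B X r {i | i ∈ S ∧ P i = c} (K' c))
    (hK : ∀ v, ∀ i ∈ S, ∀ j ∈ S, K v i j → P i = P j ∧ K' (P i) v i j) : Solves B X r S K := by
  induction r generalizing K K' with
  | zero =>
    intro v i hi j hj hij
    obtain ⟨h1, h2⟩ := hK v i hi j hj hij
    exact h (P i) v i ⟨hi, rfl⟩ j ⟨hj, h1.symm⟩ h2
  | succ r ih =>
    choose M hM hS using h
    refine ⟨fun i => M (P i) i, fun u i hi j hj hij => ?_, ih hS fun v i hi j hj hij => ?_⟩
    · obtain ⟨h1, h2⟩ := hK u i hi j hj hij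
      change M (P i) i u = M (P j) j u
      rw [← h1]
      exact hM (P i) u i ⟨hi, rfl⟩ j ⟨hj, h1.symm⟩ h2
    · obtain ⟨h1, h2⟩ := hK v i hi j hj hij.1
      refine ⟨h1, h2, fun u => ?_⟩
      have : M (P i) i u v = M (P j) j u v := hij.2 u
      rwa [← h1] at this

theorem Solves.mono {r : ℕ} {S S' : Set I} {K K' : Fin n → I → I → Prop}
    (h : Solves B X r S' K') (hS : S ⊆ S')
    (hK : ∀ v, ∀ i ∈ S, ∀ j ∈ S, K v i j → K' v i j) : Solves B X r S K := by
  induction r generalizing K K' with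
  | zero => exact fun v i hi j hj hij => h v i (hS hi) j (hS hj) (hK v i hi j hj hij)
  | succ r ih =>
    obtain ⟨M, hM, h⟩ := h
    exact ⟨M, fun u i hi j hj hij => hM u i (hS hi) j (hS hj) (hK u i hi j hj hij),
      ih h fun v i hi j hj hij => ⟨hK v i hi j hj hij.1, hij.2⟩⟩

theorem Solves.mono_rounds {r r' : ℕ} {S : Set I} {K : Fin n → I → I → Prop}
    (h : Solves B X r S K) (hr : r ≤ r') : Solves B X r' S K := by
  induction r', hr using Nat.le_induction with
  | base => exact h
  | succ r' _ ih =>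
    exact ⟨fun _ _ _ => ⟨[], by simp⟩, fun _ _ _ _ _ _ => rfl,
      ih.mono subset_rfl fun _ _ _ _ _ h => h.1⟩

theorem Solves.of_const {r : ℕ} {S : Set I} {K : Fin n → I → I → Prop} (x : Out)
    (h : ∀ i ∈ S, X i = x) : Solves B X r S K :=
  Solves.mono_rounds (r := 0) (fun _ i hi j hj _ => (h i hi).trans (h j hj).symm) (Nat.zero_le _)

theorem Solves.of_empty {r : ℕ} {S : Set I} {K : Fin n → I → I → Prop} (h : S = ∅) :
    Solves B X r S K :=
  Solves.mono_rounds (r := 0) (fun _ i hi => by simp [h] at hi) (Nat.zero_le _)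

/-- The binary encoding of a number by a string of `B` bits. -/
def encode (B x : ℕ) : Message B := ⟨List.ofFn fun k : Fin B => x.testBit k, by simp⟩

theorem encode_injOn {B x y : ℕ} (hx : x < 2 ^ B) (hy : y < 2 ^ B)
    (h : encode B x = encode B y) : x = y := by
  have h' := List.ofFn_injective (Subtype.ext_iff.1 h)
  refine Nat.eq_of_testBit_eq fun k => ?_
  rcases lt_or_ge k B with hk | hk
  · exact congrFun h' ⟨k, hk⟩
  · rw [Nat.testBit_lt_two_pow (hx.trans_le (Nat.pow_le_pow_right two_pos hk)),
      Nat.testBit_lt_two_pow (hy.trans_le (Nat.pow_le_pow_right two_pos hk))]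

/-- Direct delivery of a family of numbers, if at most `L` of them are sent over each link. -/
theorem Solves.send {ι : Type*} {src dst : ι → Fin n} (c : I → ι → ℕ) {L r : ℕ}
    {S : Set I} {K : Fin n → I → I → Prop}
    (hL : FiberBound (fun e => (src e, dst e)) L)
    (hlt : ∀ i ∈ S, ∀ e, c i e < 2 ^ B)
    (hc : ∀ e, ∀ i ∈ S, ∀ j ∈ S, K (src e) i j → c i e = c j e)
    (h : Solves B X r S fun v i j => K v i j ∧ ∀ e, dst e = v → c i e = c j e) :
    Solves B X (L + r) S K := by
  classical
  obtain ⟨idx, hidx⟩ := hL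
  have key : ∀ t, ∀ s, s + t = L → Solves B X (t + r) S fun v i j =>
      K v i j ∧ ∀ e, dst e = v → (idx e).1 < s → c i e = c j e := by
    intro t
    induction t with
    | zero =>
      intro s hs
      rw [Nat.zero_add]
      refine h.mono subset_rfl fun v i _ j _ hij => ⟨hij.1, fun e he => hij.2 e he ?_⟩
      rw [show s = L by omega]
      exact (idx e).2
    | succ t ih =>
      intro s hs
      rw [Nat.add_right_comm]
      refine ⟨fun i u w => if h : ∃ e, src e = u ∧ dst e = w ∧ (idx e).1 = s
        then encode B (c i h.choose) else ⟨[], by simp⟩, fun u i hi j hj hij => ?_, ?_⟩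
      · funext w
        dsimp only
        split_ifs with h
        · rw [hc h.choose i hi j hj]
          rw [h.choose_spec.1]
          exact hij.1
        · rfl
      · refine (ih (s + 1) (by omega)).mono subset_rfl fun v i hi j hj hij =>
          ⟨hij.1.1, fun e he hlt' => ?_⟩
        rcases Nat.lt_succ_iff_lt_or_eq.1 hlt' with hlt' | heq
        · exact hij.1.2 e he hlt'
        · have hex : ∃ e', src e' = src e ∧ dst e' = v ∧ (idx e').1 = s := ⟨e, rfl, he, heq⟩
          have h2 := hij.2 (src e)
          dsimp only at h2
          rw [dif_pos hex, dif_pos hex] at h2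
          have h3 : hex.choose = e := hidx (by
            obtain ⟨ha, hb, hc⟩ := hex.choose_spec
            simp only [Prod.mk.injEq]
            exact ⟨⟨ha, hb.trans he.symm⟩, Fin.ext (hc.trans heq.symm)⟩)
          rw [h3] at h2
          exact encode_injOn (hlt i hi e) (hlt j hj e) h2
  refine (key L 0 (by omega)).mono subset_rfl fun v i _ j _ hij => ⟨hij, fun e _ he => ?_⟩
  exact absurd he (Nat.not_lt_zero _)

/-- A family of numbers becomes common knowledge, if at most `L` of them are held by each node. -/
theorem Solves.announce {ι : Type*} {src : ι → Fin n} (c : I → ι → ℕ) {L r : ℕ}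
    {S : Set I} {K : Fin n → I → I → Prop} (hL : FiberBound src L)
    (hlt : ∀ i ∈ S, ∀ e, c i e < 2 ^ B)
    (hc : ∀ e, ∀ i ∈ S, ∀ j ∈ S, K (src e) i j → c i e = c j e)
    (h : ∀ x : ι → ℕ, Solves B X r {i | i ∈ S ∧ c i = x} K) : Solves B X (L + r) S K := by
  obtain ⟨idx, hidx⟩ := hL
  refine Solves.send (ι := ι × Fin n) (src := fun e => src e.1) (dst := fun e => e.2)
    (fun i e => c i e.1) ⟨fun e => idx e.1, fun e e' hee => ?_⟩ (fun i hi e => hlt i hi e.1)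
    (fun e => hc e.1) ?_
  · simp only [Prod.mk.injEq] at hee
    exact Prod.ext (hidx (by simp [hee])) hee.1.2
  · refine Solves.of_forall_fiber c (K' := fun _ => K) h fun v i _ j _ hij => ⟨?_, hij.1⟩
    funext e
    exact hij.2 (e, v) rfl

/-- Delivery of a family of numbers through intermediate nodes. -/
theorem Solves.route {ι : Type*} [Fintype ι] {src dst : ι → Fin n} (c : I → ι → ℕ) {a b L r : ℕ}
    {S : Set I} {K : Fin n → I → I → Prop}
    (ha : FiberBound src a) (hb : FiberBound dst b) (hL : a + b ≤ n * L)
    (hlt : ∀ i ∈ S, ∀ e, c i e < 2 ^ B)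
    (hc : ∀ e, ∀ i ∈ S, ∀ j ∈ S, K (src e) i j → c i e = c j e)
    (h : Solves B X r S fun v i j => K v i j ∧ ∀ e, dst e = v → c i e = c j e) :
    Solves B X (L + (L + r)) S K := by
  obtain ⟨ρ, h1, h2⟩ := exists_relay (C := Fin n) ha hb (by simpa using hL)
  refine Solves.send (src := src) (dst := ρ) c h1 hlt hc ?_
  refine Solves.send (src := ρ) (dst := dst) c ?_ hlt (fun e i hi j hj hij => hij.2 e rfl) ?_
  · exact h2.of_factor (fun x => (x.2, x.1)) fun e => rfl
  · exact h.mono subset_rfl fun v i _ j _ hij => ⟨hij.1.1, hij.2⟩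

/-- Unrolls the recursion into one message function per round, which depends only on the initial
knowledge and on the messages received earlier. -/
theorem Solves.exists_messages {r : ℕ} {S : Set I} {K : Fin n → I → I → Prop}
    (h : Solves B X r S K) : ∃ M : ℕ → I → Fin n → Fin n → Message B,
      (∀ t < r, ∀ u, ∀ i ∈ S, ∀ j ∈ S, K u i j → (∀ s < t, ∀ w, M s i w u = M s j w u) →
        M t i u = M t j u) ∧
      ∀ v, ∀ i ∈ S, ∀ j ∈ S, K v i j → (∀ s < r, ∀ w, M s i w v = M s j w v) → X i = X j := by
  induction r generalizing K with
  | zero => exact ⟨fun _ _ _ _ => ⟨[], by simp⟩, by simp, fun v i hi j hj hij _ => h v i hi j hj hij⟩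
  | succ r ih =>
    obtain ⟨M₀, hM₀, h⟩ := h
    obtain ⟨M, hM, hX⟩ := ih h
    refine ⟨fun t => Nat.casesOn t M₀ M, fun t ht u i hi j hj hij hs => ?_,
      fun v i hi j hj hij hs => ?_⟩
    · cases t with
      | zero => exact hM₀ u i hi j hj hij
      | succ t =>
        exact hM t (by omega) u i hi j hj ⟨hij, hs 0 (by omega)⟩ fun s hst => hs (s + 1) (by omega)
    · exact hX v i hi j hj ⟨hij, hs 0 (by omega)⟩ fun s hst => hs (s + 1) (by omega)

/-- The initial knowledge: a node knows its neighbours. -/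
def localView (v : Fin n) (G G' : SimpleGraph (Fin n)) : Prop :=
  G.neighborSet v = G'.neighborSet v

/-- A node keeps the set of all inputs in `S` consistent with what it has seen. Any element of this
set yields the correct next message, and after `r` rounds the correct output, because neither can
differ on indistinguishable inputs. -/
theorem Solves.exists_algorithm {X : SimpleGraph (Fin n) → Out} {r : ℕ}
    {S : Set (SimpleGraph (Fin n))} (h : Solves B X r S localView) :
    ∃ A : Algorithm n B Out, ∀ G ∈ S, ∀ v, A.DecidesAt G v r (X G) := by
  classical
  obtain ⟨M, hM, hX⟩ := h.exists_messages
  let A : Algorithm n B Out :=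
    { State := Fin n × ℕ × Set (SimpleGraph (Fin n))
      init := fun v N => (v, 0, {G | G ∈ S ∧ N = G.neighborSet v})
      send := fun σ w => if h : σ.2.2.Nonempty then M σ.2.1 h.some σ.1 w else ⟨[], by simp⟩
      receive := fun σ m => (σ.1, σ.2.1 + 1, {G | G ∈ σ.2.2 ∧ ∀ u, m u = M σ.2.1 G u σ.1})
      output := fun σ => if h : σ.2.1 = r ∧ σ.2.2.Nonempty then some (X h.2.some) else none }
  have hA : ∀ G ∈ S, ∀ t ≤ r, ∀ v, A.stateAfter G t v =
      (v, t, {G' | (G' ∈ S ∧ localView v G G') ∧ ∀ s < t, ∀ u, M s G u v = M s G' u v}) := by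
    intro G hG t
    induction t with
    | zero =>
      intro _ v
      simp [Algorithm.stateAfter, A, localView]
    | succ t ih =>
      intro ht v
      have hs : ∀ u, A.send (A.stateAfter G t u) v = M t G u v := by
        intro u
        rw [ih (by omega)]
        have hne : {G' | (G' ∈ S ∧ localView u G G') ∧
            ∀ s < t, ∀ w, M s G w u = M s G' w u}.Nonempty := ⟨G, ⟨hG, rfl⟩, fun _ _ _ => rfl⟩
        change dite _ _ _ = _
        rw [dif_pos hne]
        obtain ⟨⟨h1, h2⟩, h3⟩ := hne.some_mem
        exact congrFun (hM t (by omega) u G hG _ h1 h2 h3).symm v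
      rw [Algorithm.stateAfter]
      simp only [hs]
      rw [ih (by omega)]
      refine Prod.ext rfl (Prod.ext rfl (Set.ext fun G' => ?_))
      change (_ ∧ _) ↔ _
      simp only [Set.mem_ofPred_eq, and_assoc]
      refine and_congr_right fun _ => and_congr_right fun _ => ?_
      constructor
      · rintro ⟨h1, h2⟩ s hs
        rcases Nat.lt_succ_iff_lt_or_eq.1 hs with hs | rfl
        · exact h1 s hs
        · exact h2
      · exact fun h => ⟨fun s hs => h s (by omega), h t (by omega)⟩
  refine ⟨A, fun G hG v => ⟨?_, fun s hs => ?_⟩⟩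
  · rw [hA G hG r le_rfl v]
    have hne : {G' | (G' ∈ S ∧ localView v G G') ∧
        ∀ s < r, ∀ w, M s G w v = M s G' w v}.Nonempty := ⟨G, ⟨hG, rfl⟩, fun _ _ _ => rfl⟩
    change dite _ _ _ = _
    rw [dif_pos ⟨rfl, hne⟩]
    obtain ⟨⟨h1, h2⟩, h3⟩ := hne.some_mem
    exact congrArg some (hX v G hG _ h1 h2 h3).symm
  · rw [hA G hG s hs.le v]
    exact dif_neg fun h => hs.ne h.1

end Knowledge

/-! ### Girth and the Moore bound -/

section Girth

variable {V : Type*} {G : SimpleGraph V}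

/-- The graph formed by the edges of both paths is not a forest, since paths in forests are unique.
A cycle in it repeats no edge, so it is no longer than the two paths together. -/
theorem egirth_le_of_isPath_of_ne {u v : V} {p q : G.Walk u v} (hp : p.IsPath) (hq : q.IsPath)
    (hne : p ≠ q) : G.egirth ≤ (p.length + q.length : ℕ) := by
  classical
  set H : SimpleGraph V := SimpleGraph.fromEdgeSet {e | e ∈ p.edges ++ q.edges} with hH
  have hHG : H ≤ G := by
    intro a b hab
    rw [hH, SimpleGraph.fromEdgeSet_adj] at hab
    rcases List.mem_append.1 hab.1 with h | h
    · exact p.adj_of_mem_edges h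
    · exact q.adj_of_mem_edges h
  have hpH : ∀ e ∈ p.edges, e ∈ H.edgeSet := fun e he => by
    rw [hH, SimpleGraph.edgeSet_fromEdgeSet]
    exact ⟨List.mem_append_left _ he, G.not_isDiag_of_mem_edgeSet (p.edges_subset_edgeSet he)⟩
  have hqH : ∀ e ∈ q.edges, e ∈ H.edgeSet := fun e he => by
    rw [hH, SimpleGraph.edgeSet_fromEdgeSet]
    exact ⟨List.mem_append_right _ he, G.not_isDiag_of_mem_edgeSet (q.edges_subset_edgeSet he)⟩
  have hnac : ¬ H.IsAcyclic := fun hac => by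
    have := (hac.subsingleton_path u v).elim ⟨_, hp.transfer hpH⟩ ⟨_, hq.transfer hqH⟩
    have h2 := congrArg (fun w : H.Path u v => (w : H.Walk u v).support) this
    simp only [SimpleGraph.Walk.support_transfer] at h2
    exact hne (SimpleGraph.Walk.ext_support h2)
  simp only [SimpleGraph.IsAcyclic, not_forall, not_not] at hnac
  obtain ⟨a, c, hc⟩ := hnac
  have hlen : c.length ≤ p.length + q.length := by
    rw [← c.length_edges, ← p.length_edges, ← q.length_edges, ← List.length_append]
    refine List.Subperm.length_le (List.subperm_of_subset hc.edges_nodup fun e he => ?_)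
    have := c.edges_subset_edgeSet he
    rw [hH, SimpleGraph.edgeSet_fromEdgeSet] at this
    exact this.1
  calc G.egirth ≤ H.egirth := SimpleGraph.egirth_anti hHG
    _ ≤ c.length := SimpleGraph.egirth_le_length hc
    _ ≤ _ := by exact_mod_cast hlen

/-- Paths of length at most `k` from a fixed vertex are determined by their ends, as two of them
would close a cycle of length at most `2 * k`. So a path of length below `k` meets only one
neighbour of its end, the penultimate vertex, and each level is at least `t` times as large as the
one before. -/
theorem pow_le_card_of_egirth [Fintype V] {U : Set V} {t k : ℕ} (hU : U.Nonempty)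
    (hadj : ∀ v w, G.Adj v w → w ∈ U)
    (hdeg : ∀ v ∈ U, t + 1 ≤ (G.neighborSet v).ncard) (hg : ((2 * k : ℕ) : ℕ∞) < G.egirth) :
    t ^ k ≤ Fintype.card V := by
  classical
  obtain ⟨u, hu⟩ := hU
  have huniq : ∀ x (p q : G.Walk u x), p.IsPath → q.IsPath → p.length ≤ k → q.length ≤ k →
      p = q := by
    intro x p q hp hq hpk hqk
    by_contra hne
    refine absurd (egirth_le_of_isPath_of_ne hp hq hne) (not_le.2 (lt_of_le_of_lt ?_ hg))
    exact_mod_cast (by omega)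
  let P : ℕ → Finset V := fun j => Finset.univ.filter fun x =>
    ∃ p : G.Walk u x, p.IsPath ∧ p.length = j
  have hmem : ∀ j x, x ∈ P j ↔ ∃ p : G.Walk u x, p.IsPath ∧ p.length = j := by simp [P]
  have hPU : ∀ j, ∀ x ∈ P j, x ∈ U := by
    intro j x hx
    obtain ⟨p, -, -⟩ := (hmem j x).1 hx
    rcases eq_or_ne x u with rfl | hne
    · exact hu
    · have hnil : ¬ p.Nil := fun h => hne h.eq.symm
      exact hadj _ _ (p.adj_penultimate hnil)
  have hstep : ∀ j < k, t * (P j).card ≤ (P (j + 1)).card := by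
    intro j hj
    -- each vertex reached by a path of length `j` has at least `t` new neighbours
    have hnew : ∀ x ∈ P j, t ≤ ((P (j + 1)).filter fun y => G.Adj x y ∧
        ∃ p : G.Walk u x, p.IsPath ∧ p.length = j ∧ y ∉ p.support).card := by
      intro x hx
      obtain ⟨p, hp, hpj⟩ := (hmem j x).1 hx
      have hd := hdeg x (hPU j x hx)
      rw [Set.ncard_eq_toFinset_card'] at hd
      have hsub : (G.neighborSet x).toFinset ⊆ insert p.penultimate
          ((P (j + 1)).filter fun y => G.Adj x y ∧
            ∃ p : G.Walk u x, p.IsPath ∧ p.length = j ∧ y ∉ p.support) := by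
        intro y hy
        rw [Set.mem_toFinset, SimpleGraph.mem_neighborSet] at hy
        rw [Finset.mem_insert]
        by_cases hys : y ∈ p.support
        · left
          have hq : ((p.takeUntil y hys).concat hy.symm).IsPath := by
            rw [SimpleGraph.Walk.concat_isPath_iff]
            exact ⟨hp.takeUntil hys, SimpleGraph.Walk.endpoint_notMem_support_takeUntil hp hys hy.ne⟩
          have hlt : (p.takeUntil y hys).length < p.length :=
            p.length_takeUntil_lt_length hys hy.ne.symm
          have heq := huniq x p _ hp hq (by omega)
            (by rw [SimpleGraph.Walk.length_concat]; omega)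
          rw [heq]
          simp
        · right
          refine Finset.mem_filter.2 ⟨(hmem _ _).2 ⟨p.concat hy, ?_, by simp [hpj]⟩, hy, p, hp, hpj,
            hys⟩
          exact (SimpleGraph.Walk.concat_isPath_iff _).2 ⟨hp, hys⟩
      have := (Finset.card_le_card hsub).trans (Finset.card_insert_le _ _)
      omega
    calc t * (P j).card = ∑ x ∈ P j, t := by rw [Finset.sum_const, smul_eq_mul, mul_comm]
      _ ≤ ∑ x ∈ P j, ((P (j + 1)).filter fun y => G.Adj x y ∧
            ∃ p : G.Walk u x, p.IsPath ∧ p.length = j ∧ y ∉ p.support).card :=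
          Finset.sum_le_sum hnew
      _ = ((P j).biUnion fun x => (P (j + 1)).filter fun y => G.Adj x y ∧
            ∃ p : G.Walk u x, p.IsPath ∧ p.length = j ∧ y ∉ p.support).card := by
          refine (Finset.card_biUnion fun x hx x' hx' hne => ?_).symm
          refine Finset.disjoint_left.2 fun y hy hy' => hne ?_
          obtain ⟨-, ha, p, hp, hpj, hys⟩ := Finset.mem_filter.1 hy
          obtain ⟨-, ha', p', hp', hpj', hys'⟩ := Finset.mem_filter.1 hy'
          have := huniq y (p.concat ha) (p'.concat ha')
            ((SimpleGraph.Walk.concat_isPath_iff _).2 ⟨hp, hys⟩)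
            ((SimpleGraph.Walk.concat_isPath_iff _).2 ⟨hp', hys'⟩)
            (by rw [SimpleGraph.Walk.length_concat]; omega)
            (by rw [SimpleGraph.Walk.length_concat]; omega)
          simpa using congrArg SimpleGraph.Walk.penultimate this
      _ ≤ (P (j + 1)).card := Finset.card_le_card <| Finset.biUnion_subset.2 fun x _ =>
          Finset.filter_subset _ _
  have hall : ∀ j ≤ k, t ^ j ≤ (P j).card := by
    intro j
    induction j with
    | zero =>
      intro _
      exact Finset.card_pos.2 ⟨u, (hmem 0 u).2 ⟨SimpleGraph.Walk.nil, by simp⟩⟩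
    | succ j ih =>
      intro hj
      calc t ^ (j + 1) = t * t ^ j := by ring
        _ ≤ t * (P j).card := Nat.mul_le_mul_left _ (ih (by omega))
        _ ≤ _ := hstep j (by omega)
  exact (hall k le_rfl).trans (Finset.card_le_univ _)

/-- A graph of average degree more than `2 * t` has a subgraph of minimum degree more than `t`. -/
theorem exists_subgraph_lt_degree [Fintype V] (G : SimpleGraph V) {t : ℕ}
    (h : 2 * t * Fintype.card V < ∑ v, (G.neighborSet v).ncard) :
    ∃ U : Set V, U.Nonempty ∧ ∀ v ∈ U, t + 1 ≤ (G.neighborSet v ∩ U).ncard := by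
  classical
  -- Twice the number of induced edges minus `2 * t` per vertex. Deleting a vertex of induced degree
  -- at most `t` does not decrease it, so a smallest maximiser has no such vertex; it is nonempty
  -- because the whole vertex set has a positive value.
  let f : Finset V → ℤ := fun U =>
    ∑ v ∈ U, ((U.filter fun w => G.Adj v w).card : ℤ) - 2 * t * U.card
  obtain ⟨U₀, -, hU₀⟩ := Finset.exists_max_image Finset.univ f ⟨∅, Finset.mem_univ _⟩
  obtain ⟨U, hUmax, hUmin⟩ := Finset.exists_min_image
    (Finset.univ.filter fun U => ∀ W, f W ≤ f U) Finset.card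
    ⟨U₀, Finset.mem_filter.2 ⟨Finset.mem_univ _, fun W => hU₀ W (Finset.mem_univ _)⟩⟩
  have hmax : ∀ W, f W ≤ f U := (Finset.mem_filter.1 hUmax).2
  have hU : U.Nonempty := by
    rw [Finset.nonempty_iff_ne_empty]
    rintro rfl
    have h1 := hmax Finset.univ
    have h2 : ∀ v, (G.neighborSet v).ncard = (Finset.univ.filter fun w => G.Adj v w).card := by
      intro v
      rw [← Set.ncard_coe_finset]
      congr 1
      ext w
      simp
    simp only [f, Finset.sum_empty, Finset.card_empty] at h1
    simp only [h2] at h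
    have h3 : (2 * t * Fintype.card V : ℤ) <
      ∑ v, ((Finset.univ.filter fun w => G.Adj v w).card : ℤ) := by exact_mod_cast h
    rw [Finset.card_univ] at h1
    simp at h1
    linarith
  refine ⟨U, hU, fun v hv => ?_⟩
  have hcard : (G.neighborSet v ∩ (U : Set V)).ncard = (U.filter fun w => G.Adj v w).card := by
    rw [← Set.ncard_coe_finset]
    congr 1
    ext w
    simp [and_comm]
  rw [hcard]
  by_contra hlt
  have hle : (U.filter fun w => G.Adj v w).card ≤ t := by omega
  have hpos : 0 < U.card := Finset.card_pos.2 hU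
  have hsplit : ∀ w ∈ U, ((U.filter fun x => G.Adj w x).card : ℤ) =
      ((U.erase v).filter fun x => G.Adj w x).card + if G.Adj w v then 1 else 0 := by
    intro w _
    conv_lhs => rw [← Finset.insert_erase hv]
    rw [Finset.filter_insert]
    split_ifs with hwv
    · rw [Finset.card_insert_of_notMem (by simp)]
      push_cast
      ring
    · simp
  have hfe : f U ≤ f (U.erase v) := by
    simp only [f]
    rw [← Finset.add_sum_erase _ _ hv, Finset.card_erase_of_mem hv,
      Finset.sum_congr rfl fun w hw => hsplit w (Finset.mem_of_mem_erase hw),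
      Finset.sum_add_distrib]
    have h4 : ∑ w ∈ U.erase v, (if G.Adj w v then (1 : ℤ) else 0) ≤
        (U.filter fun w => G.Adj v w).card := by
      rw [Finset.sum_boole]
      refine Int.ofNat_le.2 (Finset.card_le_card fun w hw => ?_)
      rw [Finset.mem_filter] at hw ⊢
      exact ⟨Finset.mem_of_mem_erase hw.1, hw.2.symm⟩
    have h5 : ((U.filter fun w => G.Adj v w).card : ℤ) ≤ t := by exact_mod_cast hle
    push_cast [Nat.cast_sub (show 1 ≤ U.card from hpos)]
    linarith
  have := hUmin (U.erase v) (Finset.mem_filter.2 ⟨Finset.mem_univ _, fun W => (hmax W).trans hfe⟩)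
  rw [Finset.card_erase_of_mem hv] at this
  omega

/-- The Moore bound: a graph with many edges has a short cycle. -/
theorem sum_degree_le_of_egirth [Fintype V] (G : SimpleGraph V) {t k : ℕ}
    (hg : ((2 * k : ℕ) : ℕ∞) < G.egirth) (ht : Fintype.card V < t ^ k) :
    ∑ v, (G.neighborSet v).ncard ≤ 2 * t * Fintype.card V := by
  by_contra! h
  obtain ⟨U, hU, hdeg⟩ := exists_subgraph_lt_degree G h
  let H : SimpleGraph V :=
    { Adj := fun v w => G.Adj v w ∧ v ∈ U ∧ w ∈ U
      symm := ⟨fun v w h => ⟨h.1.symm, h.2.2, h.2.1⟩⟩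
      loopless := ⟨fun v h => G.loopless.irrefl v h.1⟩ }
  have hHG : H ≤ G := fun v w h => h.1
  refine absurd (pow_le_card_of_egirth (G := H) hU (fun v w h => h.2.2) (t := t) (k := k)
    (fun v hv => ?_) (hg.trans_le (SimpleGraph.egirth_anti hHG))) (not_le.2 ht)
  convert hdeg v hv using 2
  ext w
  exact ⟨fun h => ⟨h.1, h.2.2⟩, fun h => ⟨h.1, hv, h.2⟩⟩

theorem four_le_egirth_of_cliqueFree (h : G.CliqueFree 3) : 4 ≤ G.egirth := by
  rw [SimpleGraph.le_egirth]
  intro a w hw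
  have h3 := hw.three_le_length
  have hne : w.length ≠ 3 := fun h' => by
    obtain ⟨s, hs⟩ := SimpleGraph.is3Clique_iff_exists_cycle_length_three.2 ⟨a, w, hw, h'⟩
    exact h s hs
  exact_mod_cast (by omega : 4 ≤ w.length)

end Girth

/-! ### Balanced universal hashing -/

section HashFamily

/-- A universal family of hash functions which distribute the weights `d` evenly. -/
theorem exists_hash_family {n k Q : ℕ} [Fact Q.Prime] (hn : n ≤ Q ^ (k + 1)) (d : Fin n → ℕ)
    (hd : ∀ v, d v ≤ n) :
    ∃ h : (Fin k → ZMod Q) → Fin n → ZMod Q,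
      (∀ a i, Q * ∑ v with h a v = i, d v ≤ Q * n + ∑ v, d v) ∧
      ∀ x y, x ≠ y → Q * (Finset.univ.filter fun a => h a x = h a y).card ≤ Q ^ k := by
  classical
  have hQ : 0 < Q := (Fact.out : Q.Prime).pos
  let σ : Equiv.Perm (Fin n) := Tuple.sort fun v => OrderDual.toDual (d v)
  have hσ : ∀ i j, i ≤ j → d (σ j) ≤ d (σ i) := fun i j hij =>
    Tuple.monotone_sort (fun v => OrderDual.toDual (d v)) hij
  let rank : Fin n → ℕ := fun v => (σ.symm v).1
  have hrank : ∀ v, rank v < n := fun v => (σ.symm v).2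
  have hrank_inj : ∀ v w, rank v = rank w → v = w := fun v w h =>
    σ.symm.injective (Fin.ext h)
  have hrow : ∀ v, rank v / Q < Q ^ k := fun v => by
    rw [Nat.div_lt_iff_lt_mul hQ, ← pow_succ]
    exact (hrank v).trans_le hn
  let φ : Fin (Q ^ k) ≃ (Fin k → ZMod Q) := Fintype.equivOfCardEq (by simp [ZMod.card])
  let digit : Fin n → Fin k → ZMod Q := fun v => φ ⟨rank v / Q, hrow v⟩
  have hdigit : ∀ v w, digit v = digit w ↔ rank v / Q = rank w / Q := fun v w => by
    simp [digit, Fin.ext_iff]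
  have hcol : ∀ v w, ((rank v : ℕ) : ZMod Q) = (rank w : ℕ) → rank v / Q = rank w / Q → v = w := by
    intro v w h1 h2
    refine hrank_inj v w ?_
    rw [ZMod.natCast_eq_natCast_iff'] at h1
    rw [← Nat.div_add_mod (rank v) Q, ← Nat.div_add_mod (rank w) Q, h1, h2]
  -- Sort the vertices by decreasing weight and cut them into rows of length `Q`. The hash shifts
  -- the column index by a linear form in the digits of the row, so it is injective on every row.
  let h : (Fin k → ZMod Q) → Fin n → ZMod Q := fun a v => ∑ l, a l * digit v l + (rank v : ℕ)
  have hsep : ∀ a v w, h a v = h a w → rank v / Q = rank w / Q → v = w := by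
    intro a v w h1 h2
    refine hcol v w ?_ h2
    simp only [h, (hdigit v w).2 h2] at h1
    exact add_left_cancel h1
  refine ⟨h, fun a i => ?_, fun x y hxy => ?_⟩
  -- A class contains at most one vertex of each row, and that vertex weighs at most the average of
  -- the preceding row. Only row `0` has no predecessor; its contribution is the term `Q * n`.
  · have hrowsum : ∀ v, rank v / Q ≠ 0 →
        Q * d v ≤ ∑ w with rank w / Q + 1 = rank v / Q, d w := by
      intro v hv
      have hle : ∀ c : Fin Q, (rank v / Q - 1) * Q + c < rank v := by
        intro c
        have h1 := Nat.div_mul_le_self (rank v) Q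
        obtain ⟨r, hr⟩ := Nat.exists_eq_succ_of_ne_zero hv
        rw [hr] at h1 ⊢
        rw [Nat.succ_mul] at h1
        have := c.2
        simp only [Nat.succ_sub_one]
        omega
      let g : Fin Q → Fin n := fun c => σ ⟨(rank v / Q - 1) * Q + c, (hle c).trans (hrank v)⟩
      have hg : Function.Injective g := fun c c' hcc => by
        have := Fin.ext_iff.1 (σ.injective hcc)
        simp only [Nat.add_left_cancel_iff] at this
        exact Fin.ext this
      calc Q * d v = ∑ _c : Fin Q, d v := by simp
        _ ≤ ∑ c, d (g c) := Finset.sum_le_sum fun c _ => by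
            have := hσ ⟨(rank v / Q - 1) * Q + c, (hle c).trans (hrank v)⟩ (σ.symm v)
              (Fin.le_def.2 (hle c).le)
            rwa [Equiv.apply_symm_apply] at this
        _ = ∑ w ∈ Finset.univ.image g, d w := (Finset.sum_image fun _ _ _ _ h => hg h).symm
        _ ≤ _ := by
            refine Finset.sum_le_sum_of_subset fun w hw => ?_
            obtain ⟨c, -, rfl⟩ := Finset.mem_image.1 hw
            refine Finset.mem_filter.2 ⟨Finset.mem_univ _, ?_⟩
            have : rank (g c) = (rank v / Q - 1) * Q + c := by simp [rank, g]
            rw [this, mul_comm, Nat.mul_add_div hQ, Nat.div_eq_of_lt c.2, Nat.add_zero,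
              Nat.sub_add_cancel (Nat.one_le_iff_ne_zero.2 hv)]
    set A := Finset.univ.filter fun v => h a v = i with hA
    have hAinj : ∀ v ∈ A, ∀ w ∈ A, rank v / Q = rank w / Q → v = w := fun v hv w hw hvw =>
      hsep a v w (((Finset.mem_filter.1 hv).2).trans ((Finset.mem_filter.1 hw).2).symm) hvw
    rw [← Finset.sum_filter_add_sum_filter_not A (fun v => rank v / Q = 0), Nat.mul_add]
    refine Nat.add_le_add (Nat.mul_le_mul_left _ ?_) ?_
    · have hc : (A.filter fun v => rank v / Q = 0).card ≤ 1 := by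
        refine Finset.card_le_one.2 fun v hv w hw => ?_
        rw [Finset.mem_filter] at hv hw
        exact hAinj v hv.1 w hw.1 (hv.2.trans hw.2.symm)
      calc _ ≤ (A.filter fun v => rank v / Q = 0).card • n :=
            Finset.sum_le_card_nsmul _ _ _ fun v _ => hd v
        _ ≤ 1 * n := Nat.mul_le_mul_right _ hc
        _ = n := one_mul n
    · rw [Finset.mul_sum]
      calc _ ≤ ∑ v ∈ A with ¬ rank v / Q = 0, ∑ w with rank w / Q + 1 = rank v / Q, d w :=
            Finset.sum_le_sum fun v hv => hrowsum v (Finset.mem_filter.1 hv).2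
        _ = ∑ w, ∑ v ∈ A with ¬ rank v / Q = 0, if rank w / Q + 1 = rank v / Q then d w else 0 := by
            rw [Finset.sum_comm]
            exact Finset.sum_congr rfl fun v _ => by rw [Finset.sum_filter]
        _ ≤ ∑ w, d w := Finset.sum_le_sum fun w _ => by
            rw [← Finset.sum_filter, Finset.sum_const, smul_eq_mul]
            refine (Nat.mul_le_mul_right _ ?_).trans (one_mul _).le
            refine Finset.card_le_one.2 fun v hv w hw => ?_
            rw [Finset.mem_filter, Finset.mem_filter] at hv hw
            exact hAinj v hv.1.1 w hw.1.1 (hv.2.symm.trans hw.2)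
  · by_cases hr : rank x / Q = rank y / Q
    · rw [Finset.filter_false_of_mem fun a _ hh => hxy (hsep a x y hh hr)]
      simp
    · have : digit x ≠ digit y := fun h => hr ((hdigit x y).1 h)
      obtain ⟨l, hl⟩ := Function.ne_iff.1 this
      -- Translating a colliding key along a coordinate where the digits differ changes the hash
      -- difference by a nonzero multiple of the shift. The `Q` translates of the set of colliding
      -- keys are therefore disjoint.
      have hinj : Set.InjOn (fun z : ZMod Q × (Fin k → ZMod Q) => z.2 + Pi.single l z.1)
          (↑((Finset.univ : Finset (ZMod Q)) ×ˢ
            (Finset.univ.filter fun a => h a x = h a y)) : Set (ZMod Q × (Fin k → ZMod Q))) := by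
        rintro ⟨t, a⟩ ha ⟨t', a'⟩ ha' heq
        simp only [Finset.coe_product, Set.mem_prod, Finset.coe_filter] at ha ha'
        replace ha : h a x = h a y := by simpa using ha.2
        replace ha' : h a' x = h a' y := by simpa using ha'.2
        have hval : ∀ (t : ZMod Q) (a : Fin k → ZMod Q), h a x = h a y →
            h (a + Pi.single l t) x - h (a + Pi.single l t) y = t * (digit x l - digit y l) := by
          intro t a ha
          have hx : ∀ v, h (a + Pi.single l t) v = h a v + t * digit v l := by
            intro v
            simp only [h, Pi.add_apply, add_mul, Finset.sum_add_distrib, Pi.single_apply,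
              ite_mul, zero_mul, Finset.sum_ite_eq', Finset.mem_univ, if_true]
            ring
          rw [hx, hx, ha]
          ring
        have h1 := hval t a ha
        have h2 := hval t' a' ha'
        simp only at heq
        rw [heq, h2] at h1
        have htt : t' = t := mul_right_cancel₀ (sub_ne_zero.2 hl) h1
        rw [htt] at heq ⊢
        exact Prod.ext rfl (add_right_cancel heq)
      have := Finset.card_le_card_of_injOn (t := Finset.univ) _ (fun _ _ => Finset.mem_univ _) hinj
      simpa [Finset.card_product, ZMod.card] using this

end HashFamily

/-! ### Frobenius norms and counting lists of chunks -/

section Counting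

variable {V κ : Type*} [Fintype V] [Fintype κ]

/-- Cauchy–Schwarz inside each class, with weights `d v`: the square of the sum of the `D v j` is at
most the total weight, at most `W`, times the sum of `D v j ^ 2 / d v`. Summing over `j` replaces
the latter by `b v`. Vertices with `d v = 0` contribute nothing. -/
theorem sum_sq_sum_fiber_le [DecidableEq κ] (h : V → κ) (D : V → κ → ℕ) (d b : V → ℕ)
    (hD : ∀ v, ∑ j, D v j ^ 2 ≤ d v * b v) {W : ℕ} (hW : ∀ i, ∑ v with h v = i, d v ≤ W) :
    ∑ i, ∑ j, (∑ v with h v = i, D v j) ^ 2 ≤ W * ∑ v, b v := by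
  have hzero : ∀ v j, d v = 0 → D v j = 0 := by
    intro v j hv
    have := hD v
    rw [hv, Nat.zero_mul, Nat.le_zero, Finset.sum_eq_zero_iff] at this
    simpa using this j (Finset.mem_univ _)
  have hCS : ∀ i j, ((∑ v with h v = i, D v j : ℕ) : ℝ) ^ 2 ≤
      W * ∑ v with h v = i, (D v j : ℝ) ^ 2 / d v := by
    intro i j
    push_cast
    refine (Finset.sum_sq_le_sum_mul_sum_of_sq_le_mul _ (f := fun v => (d v : ℝ))
      (g := fun v => (D v j : ℝ) ^ 2 / d v) (fun v _ => by positivity) (fun v _ => by positivity)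
      fun v _ => ?_).trans ?_
    · rcases Nat.eq_zero_or_pos (d v) with h0 | h0
      · simp [h0, hzero v j h0]
      · have : (d v : ℝ) ≠ 0 := by positivity
        exact le_of_eq (by field_simp)
    · refine mul_le_mul_of_nonneg_right ?_ (Finset.sum_nonneg fun v _ => by positivity)
      exact_mod_cast hW i
  have : ((∑ i, ∑ j, (∑ v with h v = i, D v j) ^ 2 : ℕ) : ℝ) ≤ (W * ∑ v, b v : ℕ) := by
    calc ((∑ i, ∑ j, (∑ v with h v = i, D v j) ^ 2 : ℕ) : ℝ)
        = ∑ i, ∑ j, ((∑ v with h v = i, D v j : ℕ) : ℝ) ^ 2 := by push_cast; rfl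
      _ ≤ ∑ i, ∑ j, W * ∑ v with h v = i, (D v j : ℝ) ^ 2 / d v :=
          Finset.sum_le_sum fun i _ => Finset.sum_le_sum fun j _ => hCS i j
      _ = W * ∑ i, ∑ v with h v = i, ∑ j, (D v j : ℝ) ^ 2 / d v := by
          rw [Finset.mul_sum]
          refine Finset.sum_congr rfl fun i _ => ?_
          rw [← Finset.mul_sum, Finset.sum_comm]
      _ = W * ∑ v, ∑ j, (D v j : ℝ) ^ 2 / d v := by
          rw [Finset.sum_fiberwise]
      _ ≤ W * ∑ v, (b v : ℝ) := by
          refine mul_le_mul_of_nonneg_left (Finset.sum_le_sum fun v _ => ?_) (by positivity)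
          rw [← Finset.sum_div]
          rcases Nat.eq_zero_or_pos (d v) with h0 | h0
          · simp [h0]
          · rw [div_le_iff₀ (by positivity), mul_comm]
            exact_mod_cast hD v
      _ = _ := by push_cast; rfl
  exact_mod_cast this

theorem sum_sq_matrix_mul_le (A B : Matrix κ κ ℕ) :
    ∑ i, ∑ j, (A * B) i j ^ 2 ≤ (∑ i, ∑ j, A i j ^ 2) * ∑ i, ∑ j, B i j ^ 2 := by
  calc ∑ i, ∑ j, (A * B) i j ^ 2
      ≤ ∑ i, ∑ j, (∑ l, A i l ^ 2) * ∑ l, B l j ^ 2 :=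
        Finset.sum_le_sum fun i _ => Finset.sum_le_sum fun j _ => by
          rw [Matrix.mul_apply]
          exact Finset.sum_mul_sq_le_sq_mul_sq _ _ _
    _ = (∑ i, ∑ j, A i j ^ 2) * ∑ j, ∑ i, B i j ^ 2 := by
        rw [Finset.sum_mul]
        exact Finset.sum_congr rfl fun i _ => (Finset.mul_sum _ _ _).symm
    _ = _ := by rw [Finset.sum_comm (f := fun j i => B i j ^ 2)]

variable [DecidableEq κ]

theorem sum_sq_matrix_pow_le (A : Matrix κ κ ℕ) (k : ℕ) :
    ∑ i, ∑ j, (A ^ (k + 1)) i j ^ 2 ≤ (∑ i, ∑ j, A i j ^ 2) ^ (k + 1) := by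
  induction k with
  | zero => simp
  | succ k ih =>
    rw [pow_succ A, pow_succ (∑ i, ∑ j, A i j ^ 2)]
    exact (sum_sq_matrix_mul_le _ _).trans (Nat.mul_le_mul_right _ ih)

/-- The trace of `A ^ (k + 1) * A` is an inner product, so Cauchy–Schwarz and submultiplicativity of
the Frobenius norm bound it. -/
theorem trace_pow_le (A : Matrix κ κ ℕ) {k F : ℕ} (hA : ∑ i, ∑ j, A i j ^ 2 ≤ F ^ 2) :
    ∑ i, (A ^ (k + 2)) i i ≤ F ^ (k + 2) := by
  refine (Nat.pow_le_pow_iff_left (n := 2) two_ne_zero).1 ?_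
  have h1 : ∑ i, (A ^ (k + 2)) i i = ∑ z : κ × κ, (A ^ (k + 1)) z.1 z.2 * A z.2 z.1 := by
    rw [Fintype.sum_prod_type]
    refine Finset.sum_congr rfl fun i _ => ?_
    rw [pow_succ A (k + 1), Matrix.mul_apply]
  rw [h1]
  calc _ ≤ (∑ z : κ × κ, (A ^ (k + 1)) z.1 z.2 ^ 2) * ∑ z : κ × κ, A z.2 z.1 ^ 2 :=
        Finset.sum_mul_sq_le_sq_mul_sq _ _ _
    _ ≤ (F ^ 2) ^ (k + 1) * F ^ 2 := by
        rw [Fintype.sum_prod_type, Fintype.sum_prod_type,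
          Finset.sum_comm (f := fun x y => A (x, y).2 (x, y).1 ^ 2)]
        exact Nat.mul_le_mul ((sum_sq_matrix_pow_le A k).trans (Nat.pow_le_pow_left hA _)) hA
    _ = _ := by ring

/-- The lists of `k` chunks in which each chunk starts in the class where its predecessor ends.
A chunk is a part of the set of edges between two classes. -/
def walkLists (w : κ × κ → ℕ) : ℕ → κ → κ → Finset (List (Σ z : κ × κ, Fin (w z)))
  | 0, i, j => if i = j then {[]} else ∅
  | k + 1, i, j => (Finset.univ.filter fun c : Σ z : κ × κ, Fin (w z) => c.1.1 = i).biUnion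
      fun c => (walkLists w k c.1.2 j).map ⟨List.cons c, List.cons_injective⟩

theorem card_walkLists_le (w : κ × κ → ℕ) (k : ℕ) (i j : κ) :
    (walkLists w k i j).card ≤ (Matrix.of (fun i j => w (i, j)) ^ k) i j := by
  induction k generalizing i with
  | zero =>
    rw [walkLists, pow_zero, Matrix.one_apply]
    split_ifs <;> simp
  | succ k ih =>
    rw [walkLists, pow_succ', Matrix.mul_apply]
    refine Finset.card_biUnion_le.trans ?_
    simp only [Finset.card_map]
    rw [Finset.sum_filter, Fintype.sum_sigma, Fintype.sum_prod_type]
    simp only [Finset.sum_const, Finset.card_univ, Fintype.card_fin, smul_eq_mul, Matrix.of_apply]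
    rw [Finset.sum_comm]
    refine Finset.sum_le_sum fun l _ => ?_
    rw [Finset.sum_eq_single i (by intro b _ hb; simp [hb]) (by simp)]
    simpa using Nat.mul_le_mul_left _ (ih l)

theorem length_of_mem_walkLists {w : κ × κ → ℕ} {k : ℕ} {i j : κ}
    {l : List (Σ z : κ × κ, Fin (w z))} (hl : l ∈ walkLists w k i j) : l.length = k := by
  induction k generalizing i l with
  | zero =>
    rw [walkLists] at hl
    split_ifs at hl
    · simpa using hl
    · simp at hl
  | succ k ih =>
    rw [walkLists, Finset.mem_biUnion] at hl
    obtain ⟨c, -, hl⟩ := hl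
    obtain ⟨l', hl', rfl⟩ := Finset.mem_map.1 hl
    simp [ih hl']

/-- Completeness of the search: reading off a chunk for each dart of a walk gives an admissible
list, so no short cycle escapes all lists. -/
theorem exists_mem_walkLists {U : Type*} {G : SimpleGraph U} (h : U → κ) {w : κ × κ → ℕ}
    (R : (Σ z : κ × κ, Fin (w z)) → U → U → Prop)
    (hR : ∀ u v, G.Adj u v → ∃ c : Σ z : κ × κ, Fin (w z), c.1 = (h u, h v) ∧ R c u v)
    {u v : U} (p : G.Walk u v) :
    ∃ l ∈ walkLists w p.length (h u) (h v), ∀ e ∈ p.darts, ∃ c ∈ l, R c e.fst e.snd := by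
  induction p with
  | nil => exact ⟨[], by simp [walkLists], by simp⟩
  | @cons a b z hab p ih =>
    obtain ⟨l, hl, hlp⟩ := ih
    obtain ⟨c, hc, hcR⟩ := hR _ _ hab
    refine ⟨c :: l, ?_, ?_⟩
    · rw [SimpleGraph.Walk.length_cons, walkLists, Finset.mem_biUnion]
      refine ⟨c, Finset.mem_filter.2 ⟨Finset.mem_univ _, by rw [hc]⟩, Finset.mem_map.2 ⟨l, ?_, rfl⟩⟩
      rw [hc]
      exact hl
    · intro e he
      rw [SimpleGraph.Walk.darts_cons, List.mem_cons] at he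
      rcases he with rfl | he
      · exact ⟨c, List.mem_cons_self, hcR⟩
      · obtain ⟨c', hc', hR'⟩ := hlp e he
        exact ⟨c', List.mem_cons_of_mem _ hc', hR'⟩

end Counting

/-! ### Indexing edge ends by the degree sequence -/

section EdgeEnds

variable {n : ℕ} (d : Fin n → ℕ)

/-- The graphs with degree sequence `d`. -/
def degreeClass : Set (SimpleGraph (Fin n)) := {G | ∀ v, (G.neighborSet v).ncard = d v}

/-- The neighbour with index `e.2` of the node `e.1`, in a graph with degree sequence `d`. -/
noncomputable def nb (G : SimpleGraph (Fin n)) (e : Σ v : Fin n, Fin (d v)) : Fin n :=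
  (G.neighborSet e.1).toFinite.toFinset.toList.getD e.2 e.1

variable {d} {G : SimpleGraph (Fin n)}

theorem length_neighbors (hG : G ∈ degreeClass d) (v : Fin n) :
    (G.neighborSet v).toFinite.toFinset.toList.length = d v := by
  rw [Finset.length_toList, ← Set.ncard_eq_toFinset_card, hG v]

theorem nb_eq_getElem (hG : G ∈ degreeClass d) (e : Σ v : Fin n, Fin (d v)) :
    nb d G e = (G.neighborSet e.1).toFinite.toFinset.toList[e.2.1]'(by
      rw [length_neighbors hG]; exact e.2.2) := by
  rw [nb, List.getD_eq_getElem]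

theorem adj_nb (hG : G ∈ degreeClass d) (e : Σ v : Fin n, Fin (d v)) : G.Adj e.1 (nb d G e) := by
  have : nb d G e ∈ (G.neighborSet e.1).toFinite.toFinset.toList := by
    rw [nb_eq_getElem hG]
    exact List.getElem_mem _
  simpa using this

theorem exists_nb (hG : G ∈ degreeClass d) {v x : Fin n} (h : G.Adj v x) :
    ∃ e : Σ v : Fin n, Fin (d v), e.1 = v ∧ nb d G e = x := by
  have hx : x ∈ (G.neighborSet v).toFinite.toFinset.toList := by simpa using h
  obtain ⟨r, hr, hrx⟩ := List.mem_iff_getElem.1 hx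
  refine ⟨⟨v, r, by rwa [length_neighbors hG] at hr⟩, rfl, ?_⟩
  rw [nb_eq_getElem hG]
  exact hrx

theorem nb_mk_injective (hG : G ∈ degreeClass d) (v : Fin n) :
    Function.Injective fun r : Fin (d v) => nb d G ⟨v, r⟩ := by
  intro r r' h
  simp only [nb_eq_getElem hG] at h
  exact Fin.ext ((List.Nodup.getElem_inj_iff (Finset.nodup_toList _)).1 h)

theorem nb_eq_of_localView {G G' : SimpleGraph (Fin n)} (e : Σ v : Fin n, Fin (d v))
    (h : localView e.1 G G') : nb d G e = nb d G' e := by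
  unfold localView at h
  simp only [nb, h]

theorem eq_of_nb_eq {G G' : SimpleGraph (Fin n)} (hG : G ∈ degreeClass d) (hG' : G' ∈ degreeClass d)
    (h : ∀ e, nb d G e = nb d G' e) : G = G' := by
  ext v x
  constructor
  · intro hvx
    obtain ⟨e, rfl, rfl⟩ := exists_nb hG hvx
    rw [h]
    exact adj_nb hG' e
  · intro hvx
    obtain ⟨e, rfl, rfl⟩ := exists_nb hG' hvx
    rw [← h]
    exact adj_nb hG e

theorem le_of_mem_degreeClass (hG : G ∈ degreeClass d) (v : Fin n) : d v ≤ n := by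
  rw [← hG v]
  simpa using Set.ncard_le_card (G.neighborSet v)

theorem fiberBound_fst (hd : ∀ v, d v ≤ n) :
    FiberBound (fun e : Σ v : Fin n, Fin (d v) => e.1) n := by
  refine ⟨fun e => Fin.castLE (hd e.1) e.2, ?_⟩
  rintro ⟨v, r⟩ ⟨v', r'⟩ h
  simp only [Prod.mk.injEq] at h
  obtain ⟨rfl, h⟩ := h
  simpa using h

theorem fiberBound_const {ι : Type*} [Fintype ι] {A : Type*} (a : A) :
    FiberBound (fun _ : ι => a) (Fintype.card ι) := FiberBound.of_card le_rfl

end EdgeEnds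

/-! ### Broadcasting a sparse graph and choosing a hash function -/

section Stages

variable {n B : ℕ} {Out : Type} {X : SimpleGraph (Fin n) → Out} {S : Set (SimpleGraph (Fin n))}
  {d : Fin n → ℕ}

/-- In a sparse graph, all nodes can learn all edges. -/
theorem Solves.of_sum_degree_le (hB : n ^ 2 < 2 ^ B) (hS : S ⊆ degreeClass d) {L : ℕ}
    (hL : n + ∑ v, d v ≤ n * L) : Solves B X (L + L) S localView := by
  classical
  rcases S.eq_empty_or_nonempty with h0 | ⟨G₀, hG₀⟩
  · exact Solves.of_empty h0
  have hd := le_of_mem_degreeClass (hS hG₀)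
  have hlt : ∀ (G : SimpleGraph (Fin n)) (e : Σ v : Fin n, Fin (d v)), (nb d G e).1 < 2 ^ B :=
    fun G e => ((nb d G e).2.trans_le (Nat.le_self_pow two_ne_zero n)).trans hB
  obtain ⟨ρ, h1, h2⟩ := exists_relay (C := Fin n) (fiberBound_fst hd)
    (fiberBound_const (ι := Σ v : Fin n, Fin (d v)) ()) (L := L) (by simpa using hL)
  refine Solves.send (src := fun e : Σ v : Fin n, Fin (d v) => e.1) (dst := ρ)
    (fun G e => (nb d G e).1) h1 (fun G _ e => hlt G e)
    (fun e G _ G' _ h => congrArg _ (nb_eq_of_localView e h)) ?_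
  have h3 : FiberBound ρ L := by
    obtain ⟨idx, hidx⟩ := h2
    exact ⟨idx, fun e e' h => hidx (by simpa using h)⟩
  refine Solves.announce (r := 0) (src := ρ) (fun G e => (nb d G e).1) h3 (fun G _ e => hlt G e)
    (fun e G _ G' _ h => h.2 e rfl) fun x v G hG G' hG' _ => ?_
  rw [eq_of_nb_eq (hS hG.1) (hS hG'.1) fun e => Fin.ext (congrFun (hG.2.trans hG'.2.symm) e)]

variable {κ : Type} [DecidableEq κ]

/-- The number of pairs of neighbours of `v` with the same hash value, divided by the degree. -/
noncomputable def hashCost (d : Fin n → ℕ) (h : Fin n → κ) (G : SimpleGraph (Fin n)) (v : Fin n) :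
    ℕ :=
  (Finset.univ.filter fun z : Fin (d v) × Fin (d v) =>
    h (nb d G ⟨v, z.1⟩) = h (nb d G ⟨v, z.2⟩)).card / d v

theorem hashCost_le (h : Fin n → κ) (G : SimpleGraph (Fin n)) (v : Fin n) :
    hashCost d h G v ≤ d v := by
  refine Nat.div_le_of_le_mul ((Finset.card_le_univ _).trans ?_)
  simp

/-- Of the `d v ^ 2` pairs of neighbours, the `d v` diagonal ones always collide and each of the
others collides for at most a fraction `1 / Q` of the keys. -/
theorem sum_hashCost_le {𝒜 : Type} [Fintype 𝒜] (h : 𝒜 → Fin n → κ) {Q : ℕ}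
    (hcoll : ∀ x y, x ≠ y →
      Q * (Finset.univ.filter fun a => h a x = h a y).card ≤ Fintype.card 𝒜)
    {G : SimpleGraph (Fin n)} (hG : G ∈ degreeClass d) (v : Fin n) :
    ∑ a, Q * hashCost d (h a) G v ≤ Fintype.card 𝒜 * (Q + d v) := by
  rcases Nat.eq_zero_or_pos (d v) with h0 | h0
  · simp [hashCost, h0]
  refine Nat.le_of_mul_le_mul_left ?_ h0
  set A := Fintype.card 𝒜
  calc d v * ∑ a, Q * hashCost d (h a) G v
      = Q * ∑ a, d v * hashCost d (h a) G v := by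
        rw [Finset.mul_sum, Finset.mul_sum]
        exact Finset.sum_congr rfl fun a _ => by ring
    _ ≤ Q * ∑ a, (Finset.univ.filter fun z : Fin (d v) × Fin (d v) =>
          h a (nb d G ⟨v, z.1⟩) = h a (nb d G ⟨v, z.2⟩)).card :=
        Nat.mul_le_mul_left _ (Finset.sum_le_sum fun a _ => Nat.mul_div_le _ _)
    _ = ∑ z : Fin (d v) × Fin (d v), Q * (Finset.univ.filter fun a =>
          h a (nb d G ⟨v, z.1⟩) = h a (nb d G ⟨v, z.2⟩)).card := by
        simp only [Finset.card_filter]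
        rw [Finset.sum_comm, Finset.mul_sum]
    _ ≤ ∑ z : Fin (d v) × Fin (d v), ((if z.1 = z.2 then Q * A else 0) + A) := by
        refine Finset.sum_le_sum fun z _ => ?_
        split_ifs with hz
        · exact (Nat.mul_le_mul_left _ (Finset.card_le_univ _)).trans (Nat.le_add_right _ _)
        · rw [Nat.zero_add]
          exact hcoll _ _ fun hne => hz (nb_mk_injective hG v hne)
    _ = d v * (A * (Q + d v)) := by
        rw [Finset.sum_add_distrib, Fintype.sum_prod_type]
        simp
        ring

/-- The nodes can agree on a member of a universal family of hash functions which performs as well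
as the average. -/
theorem Solves.choose_hash {𝒜 : Type} [Fintype 𝒜] [Nonempty 𝒜] (hB : n ^ 2 < 2 ^ B)
    (hS : S ⊆ degreeClass d) (h : 𝒜 → Fin n → κ) {K Q r : ℕ} (hcard : Fintype.card 𝒜 ≤ n * K)
    (hcoll : ∀ x y, x ≠ y →
      Q * (Finset.univ.filter fun a => h a x = h a y).card ≤ Fintype.card 𝒜)
    (hnext : ∀ a, Solves B X r
      {G | G ∈ S ∧ Q * ∑ v, hashCost d (h a) G v ≤ Q * n + ∑ v, d v} localView) :
    Solves B X (K + (K + r)) S localView := by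
  classical
  obtain ⟨bal, hbal⟩ := exists_fiberBound (ι := 𝒜) (A := Fin n) (L := K) (by simpa using hcard)
  have hcost : ∀ G ∈ S, ∀ a v, hashCost d (h a) G v ≤ n := fun G hG a v =>
    (hashCost_le (h a) G v).trans (le_of_mem_degreeClass (hS hG) v)
  refine Solves.send (ι := Fin n × 𝒜) (src := fun e => e.1) (dst := fun e => bal e.2)
    (fun G e => hashCost d (h e.2) G e.1) ?_ (fun G hG e => ?_) (fun e G _ G' _ hl => ?_) ?_
  · obtain ⟨idx, hidx⟩ := hbal
    refine ⟨fun e => idx e.2, fun e e' hee => ?_⟩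
    simp only [Prod.mk.injEq] at hee
    exact Prod.ext hee.1.1 (hidx (by simp [hee]))
  · exact ((hcost G hG e.2 e.1).trans (Nat.le_self_pow two_ne_zero n)).trans_lt hB
  · have : ∀ z : Fin (d e.1), nb d G ⟨e.1, z⟩ = nb d G' ⟨e.1, z⟩ := fun z =>
      nb_eq_of_localView _ hl
    simp only [hashCost, this]
  refine Solves.announce (src := bal) (fun G a => ∑ v, hashCost d (h a) G v) hbal
    (fun G hG a => ?_) (fun a G _ G' _ hl => ?_) fun x => ?_
  · refine lt_of_le_of_lt ?_ hB
    calc _ ≤ ∑ _v : Fin n, n := Finset.sum_le_sum fun v _ => hcost G hG a v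
      _ = n ^ 2 := by simp [sq]
  · exact Finset.sum_congr rfl fun v _ => hl.2 (v, a) rfl
  · rcases Set.eq_empty_or_nonempty {G | G ∈ S ∧ (fun a => ∑ v, hashCost d (h a) G v) = x} with
      h0 | ⟨G₀, hG₀, hx⟩
    · exact Solves.of_empty h0
    -- Some key is no worse than the average. The choice depends only on the announced totals `x`,
    -- so it suits every input that shares them with `G₀`.
    obtain ⟨a, ha⟩ : ∃ a, Q * ∑ v, hashCost d (h a) G₀ v ≤ Q * n + ∑ v, d v := by
      by_contra! hcon
      have h1 : ∑ _a : 𝒜, (Q * n + ∑ v, d v) < ∑ a, ∑ v, Q * hashCost d (h a) G₀ v :=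
        Finset.sum_lt_sum_of_nonempty Finset.univ_nonempty fun a _ => by
          rw [← Finset.mul_sum]
          exact hcon a
      have h2 : ∑ a, ∑ v, Q * hashCost d (h a) G₀ v ≤ ∑ v, Fintype.card 𝒜 * (Q + d v) := by
        rw [Finset.sum_comm]
        exact Finset.sum_le_sum fun v _ => sum_hashCost_le h hcoll (hS hG₀) v
      rw [← Finset.mul_sum, Finset.sum_add_distrib] at h2
      simp only [Finset.sum_const, Finset.card_univ, smul_eq_mul, Fintype.card_fin] at h1 h2
      rw [mul_comm n Q] at h2
      exact absurd (h1.trans_le h2) (lt_irrefl _)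
    refine (hnext a).mono (fun G hG => ⟨hG.1, ?_⟩) fun v G _ G' _ hl => hl.1
    have h3 : ∑ v, hashCost d (h a) G v = x a := congrFun hG.2 a
    have h4 : ∑ v, hashCost d (h a) G₀ v = x a := congrFun hx a
    rw [h3, ← h4]
    exact ha

/-- All nodes learn the degree sequence. -/
theorem Solves.of_degreeClass (hB : n ^ 2 < 2 ^ B) {r : ℕ}
    (h : ∀ d : Fin n → ℕ, Solves B X r {G | G ∈ S ∧ G ∈ degreeClass d} localView) :
    Solves B X (1 + r) S localView := by
  refine Solves.announce (ι := Fin n) (src := id) (fun G v => (G.neighborSet v).ncard)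
    ⟨fun _ => 0, fun v v' hv => (Prod.ext_iff.1 hv).1⟩ (fun G _ v => ?_)
    (fun v G _ G' _ hl => congrArg Set.ncard hl) fun d => ?_
  · refine lt_of_le_of_lt ?_ hB
    have := Set.ncard_le_card (G.neighborSet v)
    rw [Nat.card_eq_fintype_card, Fintype.card_fin] at this
    exact this.trans (Nat.le_self_pow two_ne_zero n)
  · exact (h d).mono (fun G hG => ⟨hG.1, fun v => congrFun hG.2 v⟩) fun _ _ _ _ _ hl => hl

end Stages

/-! ### Detecting cycles of length `p` -/

section Detection

variable {n B : ℕ} {Λ κ : Type} {d : Fin n → ℕ}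

/-- The hash values of the two ends of an edge. -/
noncomputable def endClass (h : Fin n → κ) (G : SimpleGraph (Fin n)) (e : Σ v : Fin n, Fin (d v)) :
    κ × κ := (h e.1, h (nb d G e))

variable [DecidableEq κ] [DecidableEq Λ]

/-- The edges with hash values `z` which are held by the leader `g`. -/
noncomputable def cell (lead : (Σ v : Fin n, Fin (d v)) → Λ) (h : Fin n → κ)
    (G : SimpleGraph (Fin n)) (z : κ × κ) (g : Λ) : Finset (Σ v : Fin n, Fin (d v)) :=
  Finset.univ.filter fun e => lead e = g ∧ endClass h G e = z

/-- The addresses of the edges, if `x` counts the edges in each cell. -/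
abbrev Address (x : (κ × κ) × Λ → ℕ) : Type := Σ z : κ × κ, Σ g : Λ, Fin (x (z, g))

/-- The code of the edge at an address. -/
noncomputable def content (lead : (Σ v : Fin n, Fin (d v)) → Λ) (h : Fin n → κ)
    (x : (κ × κ) × Λ → ℕ) (G : SimpleGraph (Fin n)) (a : Address x) : ℕ :=
  (cell lead h G a.1 a.2.1).toList[a.2.2.1]?.elim 0 fun e => e.1.1 * n + (nb d G e).1

/-- Addresses depend only on the common counts `x`, so a routing schedule indexed by them can be
fixed in advance. For each graph with these counts they correspond bijectively to its edge ends, and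
the default value in `content` is never used. -/
theorem exists_decode {lead : (Σ v : Fin n, Fin (d v)) → Λ} {h : Fin n → κ}
    {x : (κ × κ) × Λ → ℕ} {G : SimpleGraph (Fin n)}
    (hx : ∀ z g, (cell lead h G z g).card = x (z, g)) :
    ∃ dec : Address x → Σ v : Fin n, Fin (d v), Function.Bijective dec ∧
      (∀ a, lead (dec a) = a.2.1) ∧ (∀ a, endClass h G (dec a) = a.1) ∧
      ∀ a, content lead h x G a = (dec a).1.1 * n + (nb d G (dec a)).1 := by
  have hlen : ∀ z g, (cell lead h G z g).toList.length = x (z, g) := fun z g => by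
    rw [Finset.length_toList, hx]
  let dec : Address x → Σ v : Fin n, Fin (d v) := fun a =>
    (cell lead h G a.1 a.2.1).toList[a.2.2.1]'(by rw [hlen]; exact a.2.2.2)
  have hmem : ∀ a, dec a ∈ cell lead h G a.1 a.2.1 := fun a =>
    Finset.mem_toList.1 (List.getElem_mem _)
  have hlead : ∀ a, lead (dec a) = a.2.1 := fun a => (Finset.mem_filter.1 (hmem a)).2.1
  have hclass : ∀ a, endClass h G (dec a) = a.1 := fun a => (Finset.mem_filter.1 (hmem a)).2.2
  refine ⟨dec, ⟨?_, ?_⟩, hlead, hclass, ?_⟩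
  · intro a a' haa
    have h1 := hlead a
    have h2 := hclass a
    rw [haa, hlead] at h1
    rw [haa, hclass] at h2
    obtain ⟨z, g, r⟩ := a
    obtain ⟨z', g', r'⟩ := a'
    simp only at h1 h2
    subst h1 h2
    have := (List.Nodup.getElem_inj_iff (Finset.nodup_toList _)).1 haa
    obtain rfl : r = r' := Fin.ext this
    rfl
  · intro e
    have he : e ∈ (cell lead h G (endClass h G e) (lead e)).toList := by
      rw [Finset.mem_toList]
      exact Finset.mem_filter.2 ⟨Finset.mem_univ _, rfl, rfl⟩
    obtain ⟨r, hr, hre⟩ := List.mem_iff_getElem.1 he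
    exact ⟨⟨endClass h G e, lead e, r, by rwa [hlen] at hr⟩, hre⟩
  · intro a
    have : a.2.2.1 < (cell lead h G a.1 a.2.1).toList.length := by rw [hlen]; exact a.2.2.2
    rw [content, List.getElem?_eq_getElem this]
    rfl

theorem sum_sq_card_fiber {ι : Type*} [Fintype ι] [Fintype κ] (f : ι → κ) :
    ∑ j, (Finset.univ.filter fun r => f r = j).card ^ 2 =
      (Finset.univ.filter fun z : ι × ι => f z.1 = f z.2).card := by
  simp only [Finset.card_filter, sq, Finset.sum_mul_sum]
  rw [Finset.sum_comm, Fintype.sum_prod_type]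
  refine Finset.sum_congr rfl fun r _ => ?_
  rw [Finset.sum_comm]
  refine Finset.sum_congr rfl fun r' _ => ?_
  simp [eq_comm]

/-- The graph formed by the edges in a list of chunks. -/
noncomputable def chunkGraph {C : Type} (lead : (Σ v : Fin n, Fin (d v)) → Λ) (h : Fin n → κ)
    (x : (κ × κ) × Λ → ℕ) (chunk : Address x → C) (l : List C) (G : SimpleGraph (Fin n)) :
    SimpleGraph (Fin n) :=
  SimpleGraph.fromRel fun u v => ∃ a, chunk a ∈ l ∧ content lead h x G a = u.1 * n + v.1

theorem code_injective {u v u' v' : Fin n} (h : u.1 * n + v.1 = u'.1 * n + v'.1) :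
    u = u' ∧ v = v' := by
  have hn : 0 < n := (Nat.zero_le _).trans_lt u.2
  have h1 := congrArg (· / n) h
  have h2 := congrArg (· % n) h
  simp only [mul_comm _ n, Nat.mul_add_div hn, Nat.div_eq_of_lt v.2,
    Nat.div_eq_of_lt v'.2, Nat.mul_add_mod, Nat.mod_eq_of_lt v.2, Nat.mod_eq_of_lt v'.2,
    Nat.add_zero] at h1 h2
  exact ⟨Fin.ext h1, Fin.ext h2⟩

theorem chunkGraph_le {C : Type} {lead : (Σ v : Fin n, Fin (d v)) → Λ} {h : Fin n → κ}
    {x : (κ × κ) × Λ → ℕ} {G : SimpleGraph (Fin n)} (hG : G ∈ degreeClass d)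
    (hx : ∀ z g, (cell lead h G z g).card = x (z, g)) (chunk : Address x → C) (l : List C) :
    chunkGraph lead h x chunk l G ≤ G := by
  obtain ⟨dec, -, -, -, hdec⟩ := exists_decode hx
  have key : ∀ u v : Fin n, (∃ a, chunk a ∈ l ∧ content lead h x G a = u.1 * n + v.1) →
      G.Adj u v := by
    rintro u v ⟨a, -, ha⟩
    rw [hdec] at ha
    obtain ⟨rfl, rfl⟩ := code_injective ha
    exact adj_nb hG _
  intro u v huv
  rw [chunkGraph, SimpleGraph.fromRel_adj] at huv
  rcases huv.2 with h1 | h1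
  · exact key u v h1
  · exact (key v u h1).symm

theorem sum_card_cell [Fintype Λ] (lead : (Σ v : Fin n, Fin (d v)) → Λ) (h : Fin n → κ)
    (G : SimpleGraph (Fin n)) (z : κ × κ) :
    ∑ g, (cell lead h G z g).card =
      ∑ v with h v = z.1, (Finset.univ.filter fun r : Fin (d v) => h (nb d G ⟨v, r⟩) = z.2).card := by
  simp only [cell, Finset.card_filter]
  rw [Finset.sum_comm, Fintype.sum_sigma, Finset.sum_filter]
  refine Finset.sum_congr rfl fun v _ => ?_
  split_ifs with hv
  · refine Finset.sum_congr rfl fun r _ => ?_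
    simp [endClass, Prod.ext_iff, hv, ite_and]
  · simp [endClass, Prod.ext_iff, hv]

variable [Fintype κ] [Fintype Λ]

/-- Balanced classes and few collisions bound the squared Frobenius norm of the edge counts by `2 *
Q ^ 2 * s ^ 2`. Rounding up to whole chunks adds at most one per pair of classes; this gives `6 * Q
^ 2`, relaxed to a perfect square. -/
theorem sum_sq_chunks_le {lead : (Σ v : Fin n, Fin (d v)) → Λ} {h : Fin n → κ}
    {x : (κ × κ) × Λ → ℕ} {G : SimpleGraph (Fin n)} {Q s : ℕ}
    (hx : ∀ z g, (cell lead h G z g).card = x (z, g)) (hQ : Fintype.card κ = Q)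
    (hW : ∀ i, Q * ∑ v with h v = i, d v ≤ Q * n + ∑ v, d v)
    (hcost : Q * ∑ v, hashCost d h G v ≤ Q * n + ∑ v, d v) (hs : 0 < s) (hQ0 : 0 < Q)
    (hsQ : Q * n + ∑ v, d v ≤ Q ^ 2 * s) :
    ∑ i, ∑ j, ((∑ g, x ((i, j), g)) / s + 1) ^ 2 ≤ (3 * Q) ^ 2 := by
  have hE : ∑ i, ∑ j, (∑ g, x ((i, j), g)) ^ 2 ≤ 2 * Q ^ 2 * s ^ 2 := by
    -- The summand `1` compensates for the floor in `hashCost`.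
    have h1 := sum_sq_sum_fiber_le h
      (fun v j => (Finset.univ.filter fun r : Fin (d v) => h (nb d G ⟨v, r⟩) = j).card) d
      (fun v => hashCost d h G v + 1) (fun v => ?_) (W := (Q * n + ∑ v, d v) / Q) fun i => ?_
    · have h2 : ∑ i, ∑ j, (∑ g, x ((i, j), g)) ^ 2 = _ :=
        Finset.sum_congr rfl fun i _ => Finset.sum_congr rfl fun j _ => by
          rw [← Finset.sum_congr rfl fun g _ => hx (i, j) g, sum_card_cell]
      rw [h2]
      refine h1.trans ?_
      refine Nat.le_of_mul_le_mul_left ?_ (by positivity : 0 < Q ^ 2)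
      have h3 : Q * ((Q * n + ∑ v, d v) / Q) ≤ Q ^ 2 * s := (Nat.mul_div_le _ _).trans hsQ
      have h4 : Q * ∑ v, (hashCost d h G v + 1) ≤ 2 * (Q ^ 2 * s) := by
        rw [Finset.sum_add_distrib, Nat.mul_add]
        simp only [Finset.sum_const, Finset.card_univ, Fintype.card_fin, smul_eq_mul, mul_one]
        omega
      calc _ = (Q * ((Q * n + ∑ v, d v) / Q)) * (Q * ∑ v, (hashCost d h G v + 1)) := by ring
        _ ≤ (Q ^ 2 * s) * (2 * (Q ^ 2 * s)) := Nat.mul_le_mul h3 h4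
        _ = _ := by ring
    · rw [sum_sq_card_fiber]
      rcases Nat.eq_zero_or_pos (d v) with h0 | h0
      · refine (Finset.card_le_univ _).trans ?_
        simp [h0]
      · rw [hashCost]
        exact (Nat.lt_mul_div_succ _ h0).le
    · rw [Nat.le_div_iff_mul_le hQ0, mul_comm]
      exact hW i
  refine Nat.le_of_mul_le_mul_left ?_ (by positivity : 0 < s ^ 2)
  calc s ^ 2 * ∑ i, ∑ j, ((∑ g, x ((i, j), g)) / s + 1) ^ 2
      = ∑ i, ∑ j, (s * ((∑ g, x ((i, j), g)) / s) + s) ^ 2 := by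
        simp only [Finset.mul_sum]
        exact Finset.sum_congr rfl fun i _ => Finset.sum_congr rfl fun j _ => by ring
    _ ≤ ∑ i : κ, ∑ j : κ, (2 * (∑ g, x ((i, j), g)) ^ 2 + 2 * s ^ 2) :=
        Finset.sum_le_sum fun i _ => Finset.sum_le_sum fun j _ => by
          have := Nat.mul_div_le (∑ g, x ((i, j), g)) s
          calc _ ≤ ((∑ g, x ((i, j), g)) + s) ^ 2 := Nat.pow_le_pow_left (by omega) 2
            _ ≤ _ := by nlinarith [add_sq_le (a := ∑ g, x ((i, j), g)) (b := s)]
    _ = 2 * (∑ i : κ, ∑ j : κ, (∑ g, x ((i, j), g)) ^ 2) + 2 * Q ^ 2 * s ^ 2 := by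
        simp only [Finset.sum_add_distrib, ← Finset.mul_sum, Finset.sum_const, Finset.card_univ,
          hQ, smul_eq_mul]
        ring
    _ ≤ s ^ 2 * (3 * Q) ^ 2 := by nlinarith

variable {S : Set (SimpleGraph (Fin n))} {Out : Type} {X : SimpleGraph (Fin n) → Out}

/-- The edges are gathered at few leaders, and the number of edges in each cell becomes common
knowledge. -/
theorem Solves.gather_counts (hB : n ^ 2 < 2 ^ B) (hS : S ⊆ degreeClass d) (node : Λ → Fin n)
    (hnode : Function.Injective node) (h : Fin n → κ) {lead : (Σ v : Fin n, Fin (d v)) → Λ}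
    (hlead : FiberBound lead n) {L r : ℕ}
    (hL : Fintype.card κ ^ 2 * Fintype.card Λ ≤ n * L)
    (hnext : ∀ x : (κ × κ) × Λ → ℕ, Solves B X r
      {G | G ∈ S ∧ ∀ z g, (cell lead h G z g).card = x (z, g)}
      fun v G G' => localView v G G' ∧ ∀ e, node (lead e) = v → nb d G e = nb d G' e) :
    Solves B X (2 + (2 + (L + (L + r)))) S localView := by
  classical
  rcases S.eq_empty_or_nonempty with h0 | ⟨G₀, hG₀⟩
  · exact Solves.of_empty h0
  have hd := le_of_mem_degreeClass (hS hG₀)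
  refine Solves.route (src := fun e : Σ v : Fin n, Fin (d v) => e.1) (dst := node ∘ lead)
    (fun G e => (nb d G e).1) (fiberBound_fst hd) (hlead.comp_right hnode) (by omega)
    (fun G _ e => ((nb d G e).2.trans_le (Nat.le_self_pow two_ne_zero n)).trans hB)
    (fun e G _ G' _ hl => congrArg _ (nb_eq_of_localView e hl)) ?_
  obtain ⟨bal, hbal⟩ := exists_fiberBound (ι := (κ × κ) × Λ) (A := Fin n) (L := L) (by
    simpa [sq] using hL)
  have hlt : ∀ (G : SimpleGraph (Fin n)) (e : (κ × κ) × Λ), (cell lead h G e.1 e.2).card < 2 ^ B := fun G e => by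
    refine lt_of_le_of_lt ((Finset.card_le_univ _).trans ?_) hB
    simp only [Fintype.card_sigma, Fintype.card_fin]
    exact (Finset.sum_le_sum fun v _ => hd v).trans (by simp [sq])
  refine Solves.send (src := fun e : (κ × κ) × Λ => node e.2) (dst := bal)
    (fun G e => (cell lead h G e.1 e.2).card)
    (hbal.of_factor (fun y => y.2) fun _ => rfl) (fun G _ e => hlt G e) (fun e G _ G' _ hl => ?_) ?_
  · congr 1
    refine Finset.filter_congr fun e' _ => and_congr_right fun he' => ?_
    have := Fin.ext (hl.2 e' (congrArg node he'))
    rw [endClass, endClass, this]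
  refine Solves.announce (src := bal) (fun G e => (cell lead h G e.1 e.2).card) hbal
    (fun G _ e => hlt G e) (fun e G _ G' _ hl => hl.2 e rfl) fun x => ?_
  refine (hnext x).mono (fun G hG => ⟨hG.1, fun z g => congrFun hG.2 (z, g)⟩)
    fun v G _ G' _ hl => ⟨hl.1.1, fun e he => Fin.ext (hl.1.2 e he)⟩

/-- If the number of edges in each cell is common knowledge, then the nodes can detect cycles of
length `p`. -/
theorem Solves.detect_of_counts {p k : ℕ} (hp : p = k + 2) (hB : n ^ 2 < 2 ^ B)
    (hS : S ⊆ degreeClass d) (hSp : ∀ G ∈ S, (p : ℕ∞) ≤ G.egirth) (node : Λ → Fin n)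
    (hnode : Function.Injective node) (h : Fin n → κ) {lead : (Σ v : Fin n, Fin (d v)) → Λ}
    (hlead : FiberBound lead n) {L K r s Q : ℕ} (x : (κ × κ) × Λ → ℕ)
    (hx : ∀ G ∈ S, ∀ z g, (cell lead h G z g).card = x (z, g))
    (hQ : Fintype.card κ = Q) (hQ0 : 0 < Q)
    (hW : ∀ i, Q * ∑ v with h v = i, d v ≤ Q * n + ∑ v, d v)
    (hcost : ∀ G ∈ S, Q * ∑ v, hashCost d h G v ≤ Q * n + ∑ v, d v) (hs : 0 < s)
    (hsQ : Q * n + ∑ v, d v ≤ Q ^ 2 * s) (hL : n + s ≤ n * L) (hK : (3 * Q) ^ p ≤ n * K)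
    (hnext : Solves B SimpleGraph.egirth r {G | G ∈ S ∧ (p + 1 : ℕ) ≤ G.egirth} localView) :
    Solves B SimpleGraph.egirth (L + (K * (p * L) + (K + r))) S
      fun v G G' => localView v G G' ∧ ∀ e, node (lead e) = v → nb d G e = nb d G' e := by
  classical
  rcases S.eq_empty_or_nonempty with h0 | ⟨G₀, hG₀⟩
  · exact Solves.of_empty h0
  have hn : 0 < n := by
    by_contra hn
    obtain rfl : n = 0 := by omega
    simp at hL
    omega
  -- Enough chunks of size `s` for all edges between the two classes, and computable from the common
  -- counts.
  let w : κ × κ → ℕ := fun z => (∑ g, x (z, g)) / s + 1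
  have hchunk : ∀ z, ∃ f : (Σ g : Λ, Fin (x (z, g))) → Fin (w z), FiberBound f s := fun z => by
    refine exists_fiberBound ?_
    simp only [Fintype.card_sigma, Fintype.card_fin, w]
    rw [mul_comm]
    exact (Nat.lt_mul_div_succ _ hs).le
  choose f hf using hchunk
  let chunk : Address x → Σ z : κ × κ, Fin (w z) := fun a => ⟨a.1, f a.1 a.2⟩
  have hchunk : FiberBound chunk s := by
    choose idx hidx using hf
    refine ⟨fun a => idx a.1 a.2, ?_⟩
    rintro ⟨z, a⟩ ⟨z', a'⟩ haa
    simp only [Prod.mk.injEq, chunk, Sigma.mk.injEq] at haa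
    obtain ⟨⟨rfl, h1⟩, h2⟩ := haa
    rw [hidx z (Prod.ext (eq_of_heq h1) h2)]
  have hleadA : FiberBound (fun a : Address x => node a.2.1) n := by
    obtain ⟨dec, hdec, hl, -, -⟩ := exists_decode (hx G₀ hG₀)
    have := (hlead.comp_right hnode).comp_injective hdec.1
    simpa [Function.comp_def, hl] using this
  obtain ⟨ρ, h1, h2⟩ := exists_relay (C := Fin n) hleadA hchunk (L := L) (by simpa using hL)
  have hlt : ∀ G ∈ S, ∀ a : Address x, content lead h x G a < 2 ^ B := by
    intro G hG a
    obtain ⟨dec, -, -, -, hdec⟩ := exists_decode (hx G hG)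
    rw [hdec]
    refine lt_of_lt_of_le ?_ hB.le
    have h3 := (dec a).1.2
    have h4 := (nb d G (dec a)).2
    nlinarith
  refine Solves.send (src := fun a : Address x => node a.2.1) (dst := ρ) (content lead h x) h1 hlt
    (fun a G hG G' hG' hl => ?_) ?_
  · have hcell : cell lead h G a.1 a.2.1 = cell lead h G' a.1 a.2.1 := by
      refine Finset.filter_congr fun e he => and_congr_right fun he' => ?_
      rw [endClass, endClass, hl.2 e (congrArg node he')]
    rw [content, content, ← hcell]
    rcases hget : (cell lead h G a.1 a.2.1).toList[a.2.2.1]? with _ | e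
    · rfl
    · have he := Finset.mem_toList.1 (List.mem_of_getElem? hget)
      simp only [Option.elim]
      rw [hl.2 e (congrArg node (Finset.mem_filter.1 he).2.1)]
  let Tup : Finset (List (Σ z : κ × κ, Fin (w z))) :=
    Finset.univ.biUnion fun i => walkLists w p i i
  have hTup : Tup.card ≤ n * K := by
    refine le_trans ?_ hK
    calc Tup.card ≤ ∑ i, (walkLists w p i i).card := Finset.card_biUnion_le
      _ ≤ ∑ i, (Matrix.of (fun i j => w (i, j)) ^ p) i i :=
          Finset.sum_le_sum fun i _ => card_walkLists_le w p i i
      _ ≤ (3 * Q) ^ p := by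
          rw [hp]
          exact trace_pow_le _ (sum_sq_chunks_le (hx G₀ hG₀) hQ hW (hcost G₀ hG₀) hs hQ0 hsQ)
  obtain ⟨asg, hasg⟩ := exists_fiberBound (ι := Tup) (A := Fin n) (L := K) (by simpa using hTup)
  refine Solves.send
    (ι := {y : (Tup × Fin p) × Address x // y.1.1.1[y.1.2.1]? = some (chunk y.2)})
    (src := fun y => ρ y.1.2) (dst := fun y => asg y.1.1.1) (fun G y => content lead h x G y.1.2)
    ?_ (fun G hG y => hlt G hG _) (fun y G _ G' _ hl => hl.2 _ rfl) ?_
  · obtain ⟨idx, hidx⟩ := hasg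
    obtain ⟨idx', hidx'⟩ := h2
    -- A relay sends a given node, for each of its `K` lists and each of the `p` positions, at most
    -- `L` edges of the chunk there.
    refine FiberBound.of_fintype (J := Fin K × Fin p × Fin L) (by simp)
      (fun y => (idx y.1.1.1, y.1.1.2, idx' y.1.2)) ?_
    rintro ⟨⟨⟨τ, i⟩, a⟩, hy⟩ ⟨⟨⟨τ', i'⟩, a'⟩, hy'⟩ hyy
    simp only [Prod.mk.injEq] at hyy
    obtain ⟨⟨h3, h4⟩, h5, rfl, h6⟩ := hyy
    obtain rfl : τ = τ' := hidx (Prod.ext h4 h5)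
    simp only at hy hy'
    have h7 : chunk a = chunk a' := Option.some.inj (hy.symm.trans hy')
    obtain rfl : a = a' := hidx' (by simp only [Prod.mk.injEq]; exact ⟨⟨h7, h3⟩, h6⟩)
    rfl
  refine Solves.announce (src := asg)
    (fun G τ => if (chunkGraph lead h x chunk τ.1 G).egirth ≤ p then 1 else 0) hasg
    (fun G _ τ => ?_) (fun τ G _ G' _ hl => ?_) fun β => ?_
  · have : 1 < 2 ^ B := lt_of_le_of_lt (Nat.one_le_pow _ _ hn) hB
    split_ifs <;> omega
  · have hcontent : ∀ a, chunk a ∈ τ.1 → content lead h x G a = content lead h x G' a := by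
      intro a ha
      obtain ⟨i, hi, hia⟩ := List.mem_iff_getElem.1 ha
      have hlen : τ.1.length = p := by
        obtain ⟨j, -, hj⟩ := Finset.mem_biUnion.1 τ.2
        exact length_of_mem_walkLists hj
      exact hl.2 ⟨((τ, ⟨i, by omega⟩), a), by
        simp only
        rw [List.getElem?_eq_getElem hi, hia]⟩ rfl
    have : chunkGraph lead h x chunk τ.1 G = chunkGraph lead h x chunk τ.1 G' := by
      unfold chunkGraph
      congr 1
      funext u v
      exact propext (exists_congr fun a => and_congr_right fun ha => by rw [hcontent a ha])
    rw [this]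
  by_cases hβ : ∃ τ, β τ = 1
  · obtain ⟨τ, hτ⟩ := hβ
    -- Soundness: the chunks form a subgraph of `G`, so any short cycle found in them is a cycle of
    -- `G`.
    refine Solves.of_const (p : ℕ∞) fun G hG => le_antisymm ?_ (hSp G hG.1)
    have h3 : (if (chunkGraph lead h x chunk τ.1 G).egirth ≤ p then 1 else 0) = β τ :=
      congrFun hG.2 τ
    rw [hτ] at h3
    exact (SimpleGraph.egirth_anti (chunkGraph_le (hS hG.1) (hx G hG.1) chunk τ.1)).trans
      (by simpa using h3)
  · refine hnext.mono (fun G hG => ⟨hG.1, ?_⟩) fun v G _ G' _ hl => hl.1.1.1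
    have hβ' : ∀ τ : Tup, ¬ (chunkGraph lead h x chunk τ.1 G).egirth ≤ p := fun τ hτ => hβ ⟨τ, by
      rw [← congrFun hG.2 τ]
      exact if_pos hτ⟩
    rw [SimpleGraph.le_egirth]
    intro a c hc
    have hpc : (p : ℕ∞) ≤ c.length := (hSp G hG.1).trans (SimpleGraph.egirth_le_length hc)
    have hpc : p ≤ c.length := by exact_mod_cast hpc
    rcases hpc.lt_or_eq with hlt | heq
    · exact_mod_cast hlt
    exfalso
    obtain ⟨dec, hbij, -, hclass, hdec⟩ := exists_decode (hx G hG.1)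
    obtain ⟨l, hl, hlR⟩ := exists_mem_walkLists h (w := w)
      (fun c u v => ∃ a, chunk a = c ∧ content lead h x G a = u.1 * n + v.1) (fun u v huv => by
        obtain ⟨e, rfl, rfl⟩ := exists_nb (hS hG.1) huv
        obtain ⟨a, rfl⟩ := hbij.2 e
        exact ⟨chunk a, (hclass a).symm, a, rfl, hdec a⟩) c
    rw [← heq] at hl
    refine hβ' ⟨l, Finset.mem_biUnion.2 ⟨h a, Finset.mem_univ _, hl⟩⟩ ?_
    have hedges : ∀ e ∈ c.edges, e ∈ (chunkGraph lead h x chunk l G).edgeSet := by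
      intro e he
      obtain ⟨dt, hdt, rfl⟩ := List.mem_map.1 he
      obtain ⟨_, hcl, b, rfl, hb⟩ := hlR dt hdt
      change (chunkGraph lead h x chunk l G).Adj dt.fst dt.snd
      rw [chunkGraph, SimpleGraph.fromRel_adj]
      exact ⟨dt.adj.ne, Or.inl ⟨b, hcl, hb⟩⟩
    have := SimpleGraph.egirth_le_length (hc.transfer hedges)
    rwa [SimpleGraph.Walk.length_transfer, ← heq] at this

end Detection

/-! ### Choice of parameters and induction on the girth -/

section Assembly

variable {n B : ℕ} {d : Fin n → ℕ}

/-- Bertrand's postulate applied to the least `N` with `n ≤ N ^ p`; since `N ≥ 2`, the prime is at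
most `2 * N ≤ 4 * (N - 1)`. -/
theorem exists_prime_pow_between (hn : 2 ≤ n) (p : ℕ) (hp : p ≠ 0) :
    ∃ Q : ℕ, Q.Prime ∧ n ≤ Q ^ p ∧ Q ^ p ≤ 4 ^ p * n := by
  have hex : ∃ N, n ≤ N ^ p := ⟨n, Nat.le_self_pow hp n⟩
  classical
  set N := Nat.find hex with hN
  have h1 : n ≤ N ^ p := Nat.find_spec hex
  have h2 : 2 ≤ N := by
    by_contra hlt
    have : N ^ p ≤ 1 ^ p := Nat.pow_le_pow_left (by omega) p
    rw [one_pow] at this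
    omega
  have h3 : (N - 1) ^ p < n := not_le.1 (Nat.find_min hex (by omega : N - 1 < Nat.find hex))
  obtain ⟨Q, hQ, hNQ, hQN⟩ := Nat.exists_prime_lt_and_le_two_mul N (by omega)
  refine ⟨Q, hQ, h1.trans (Nat.pow_le_pow_left hNQ.le p), ?_⟩
  calc Q ^ p ≤ (4 * (N - 1)) ^ p := Nat.pow_le_pow_left (by omega) p
    _ = 4 ^ p * (N - 1) ^ p := mul_pow _ _ _
    _ ≤ 4 ^ p * n := Nat.mul_le_mul_left _ h3.le

/-- Detection of `p`-cycles in a graph of girth at least `p` which is sufficiently sparse. -/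
theorem Solves.detect {S : Set (SimpleGraph (Fin n))} {p k Q ℓ r : ℕ} (hp : p = k + 4)
    (hn : 0 < n) (hB : n ^ 2 < 2 ^ B) (hS : S ⊆ degreeClass d)
    (hSp : ∀ G ∈ S, (p : ℕ∞) ≤ G.egirth) (hQ : Q.Prime) (hnQ : n ≤ Q ^ p)
    (hQn : Q ^ p ≤ 4 ^ p * n) (hℓ : 0 < ℓ) (hd : ∑ v, d v ≤ 4 * Q ^ 2 * n * ℓ)
    (hnext : Solves B SimpleGraph.egirth r {G | G ∈ S ∧ (p + 1 : ℕ) ≤ G.egirth} localView) :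
    Solves B SimpleGraph.egirth ((12 * 4 ^ p + 10 + (6 * p + 1) * 12 ^ p) * ℓ + r) S
      localView := by
  classical
  rcases S.eq_empty_or_nonempty with h0 | ⟨G₀, hG₀⟩
  · exact Solves.of_empty h0
  have hdn := le_of_mem_degreeClass (hS hG₀)
  have : Fact Q.Prime := ⟨hQ⟩
  have hQ0 : 0 < Q := hQ.pos
  obtain ⟨h, hW, hcoll⟩ := exists_hash_family (k := k + 3) (Q := Q) (by rwa [hp] at hnQ) d hdn
  set m := ∑ v, d v with hm
  have hmn : m ≤ n * n := (Finset.sum_le_sum fun v _ => hdn v).trans (by simp)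
  have hcardA : Fintype.card (Fin (k + 3) → ZMod Q) = Q ^ (k + 3) := by simp [ZMod.card]
  have hQ4 : Q ^ 4 ≤ 4 ^ p * n :=
    (Nat.pow_le_pow_right hQ0 (by omega : 4 ≤ p)).trans hQn
  -- The number of leaders is `m / n` rounded up: each holds at most `n` edges, and they are few
  -- enough for all their cell counts to be announced.
  obtain ⟨c, hc1, hc2, hc3⟩ : ∃ c, c ≤ n ∧ m ≤ c * n ∧ c * n ≤ m + n := by
    have h1 := Nat.div_add_mod (m + (n - 1)) n
    have h2 := Nat.mod_lt (m + (n - 1)) hn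
    refine ⟨(m + (n - 1)) / n, ?_, ?_, ?_⟩
    · rw [Nat.div_le_iff_le_mul_add_pred hn]
      omega
    · rw [mul_comm]
      omega
    · rw [mul_comm]
      omega
  obtain ⟨lead, hlead⟩ := exists_fiberBound (ι := Σ v : Fin n, Fin (d v)) (A := Fin c) (L := n)
    (by simpa using hc2)
  -- There are about `Q ^ 2 * m / n`, so `O(Q ^ 4 * ℓ)`, counts. This is `O(n * ℓ)` exactly because
  -- `p ≥ 4`, which is where triangle-freeness enters.
  have hL1 : Fintype.card (ZMod Q) ^ 2 * Fintype.card (Fin c) ≤ n * (5 * 4 ^ p * ℓ) := by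
    rw [ZMod.card, Fintype.card_fin]
    refine Nat.le_of_mul_le_mul_right ?_ hn
    have h5 : Q ^ 2 ≤ Q ^ 4 := Nat.pow_le_pow_right hQ0 (by norm_num)
    calc Q ^ 2 * c * n = Q ^ 2 * (c * n) := by ring
      _ ≤ Q ^ 2 * (4 * Q ^ 2 * n * ℓ + n) := Nat.mul_le_mul_left _ (by omega)
      _ = 4 * (Q ^ 4 * (n * ℓ)) + Q ^ 2 * (n * 1) := by ring
      _ ≤ 4 * (Q ^ 4 * (n * ℓ)) + Q ^ 4 * (n * ℓ) := by gcongr; omega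
      _ = 5 * (n * ℓ) * Q ^ 4 := by ring
      _ ≤ 5 * (n * ℓ) * (4 ^ p * n) := Nat.mul_le_mul_left _ hQ4
      _ = _ := by ring
  have hsQ : Q * n + m ≤ Q ^ 2 * (5 * n * ℓ) := by
    calc Q * n + m ≤ Q ^ 2 * (n * ℓ) + 4 * Q ^ 2 * n * ℓ := by
          refine Nat.add_le_add (Nat.mul_le_mul (Nat.le_self_pow two_ne_zero Q) ?_) hd
          exact Nat.le_mul_of_pos_right n hℓ
      _ = _ := by ring
  have hL : n + 5 * n * ℓ ≤ n * (6 * ℓ) := by nlinarith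
  have hK : (3 * Q) ^ p ≤ n * 12 ^ p := by
    calc (3 * Q) ^ p = 3 ^ p * Q ^ p := mul_pow _ _ _
      _ ≤ 3 ^ p * (4 ^ p * n) := Nat.mul_le_mul_left _ hQn
      _ = n * (3 * 4) ^ p := by rw [mul_pow]; ring
      _ = _ := by norm_num
  have hmain := Solves.choose_hash (B := B) (X := SimpleGraph.egirth) hB hS h (K := 4 ^ p)
    (Q := Q) (by
      rw [hcardA, mul_comm]
      exact (Nat.pow_le_pow_right hQ0 (by omega)).trans hQn) (by rwa [hcardA]) fun a =>
    Solves.gather_counts hB (fun G hG => hS hG.1) (Fin.castLE hc1) (Fin.castLE_injective hc1) (h a)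
      hlead hL1 fun x =>
        Solves.detect_of_counts (p := p) (k := k + 2) (s := 5 * n * ℓ) (Q := Q) hp hB
          (fun G hG => hS hG.1.1) (fun G hG => hSp G hG.1.1) (Fin.castLE hc1)
          (Fin.castLE_injective hc1) (h a) hlead x (fun G hG => hG.2) (ZMod.card Q) hQ0 (hW a)
          (fun G hG => hG.1.2) (by positivity) hsQ hL hK
          (hnext.mono (fun G hG => ⟨hG.1.1.1, hG.2⟩) fun _ _ _ _ _ hl => hl)
  refine hmain.mono_rounds ?_
  have h1 : 4 ^ p ≤ 4 ^ p * ℓ := Nat.le_mul_of_pos_right _ hℓ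
  have h2 : 12 ^ p ≤ 12 ^ p * ℓ := Nat.le_mul_of_pos_right _ hℓ
  have h3 : (12 * 4 ^ p + 10 + (6 * p + 1) * 12 ^ p) * ℓ =
      12 * (4 ^ p * ℓ) + 10 * ℓ + 12 ^ p * (p * (6 * ℓ)) + 12 ^ p * ℓ := by ring
  have h4 : 5 * 4 ^ p * ℓ = 5 * (4 ^ p * ℓ) := by ring
  rw [h3, h4]
  omega

/-- This is what the Moore bound needs in the dense case. For even `p` the factor `Q` suffices. For
`p = 2 * j + 1` the exponents require `j * (2 * j + 1) ≥ 10`, with equality for `p = 5`: five-cycles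
dictate the exponent `1/10`. -/
theorem le_pow_mul_pow {Q p ℓ : ℕ} (hp : 4 ≤ p) (hQ : 0 < Q) (hℓ : 0 < ℓ) (hnQ : n ≤ Q ^ p)
    (hnℓ : n ≤ ℓ ^ 10) : n ≤ (Q ^ 2 * ℓ) ^ (p / 2) := by
  rcases Nat.eq_zero_or_pos n with rfl | hn
  · exact Nat.zero_le _
  obtain ⟨j, hj⟩ : ∃ j, p / 2 = j := ⟨_, rfl⟩
  rw [hj]
  have hj2 : 2 ≤ j := by omega
  rcases Nat.even_or_odd' p with ⟨i, hi | hi⟩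
  · obtain rfl : j = i := by omega
    rw [mul_pow, ← pow_mul, ← hi]
    exact hnQ.trans (Nat.le_mul_of_pos_right _ (by positivity))
  · obtain rfl : j = i := by omega
    refine (Nat.pow_le_pow_iff_left (n := 10 * (2 * j + 1)) (by omega)).1 ?_
    calc n ^ (10 * (2 * j + 1)) ≤ n ^ (20 * j + j * (2 * j + 1)) :=
          Nat.pow_le_pow_right hn (by nlinarith)
      _ = n ^ (20 * j) * n ^ (j * (2 * j + 1)) := pow_add _ _ _
      _ ≤ (Q ^ p) ^ (20 * j) * (ℓ ^ 10) ^ (j * (2 * j + 1)) :=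
          Nat.mul_le_mul (Nat.pow_le_pow_left hnQ _) (Nat.pow_le_pow_left hnℓ _)
      _ = ((Q ^ 2 * ℓ) ^ j) ^ (10 * (2 * j + 1)) := by
          rw [hi]
          ring

theorem exists_rounds_of_le_egirth (j p : ℕ) (hp : 4 ≤ p) (hj : p + j = 21) :
    ∃ C : ℕ, ∀ n B ℓ : ℕ, 2 ≤ n → n ^ 2 < 2 ^ B → n ≤ ℓ ^ 10 → ∀ d : Fin n → ℕ,
      Solves B SimpleGraph.egirth (C * ℓ)
        {G | G ∈ degreeClass d ∧ (p : ℕ∞) ≤ G.egirth} localView := by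
  induction j generalizing p with
  | zero =>
    obtain rfl : p = 21 := by omega
    refine ⟨10, fun n B ℓ hn hB hℓ d => ?_⟩
    have hℓ0 : 0 < ℓ := by
      by_contra h0
      obtain rfl : ℓ = 0 := by omega
      simp at hℓ
      omega
    rcases Set.eq_empty_or_nonempty {G | G ∈ degreeClass d ∧ ((21 : ℕ) : ℕ∞) ≤ G.egirth} with
      h0 | ⟨G₀, hG₀, hg⟩
    · exact Solves.of_empty h0
    -- Girth at least `21 > 2 * 10` allows `k = 10`, which matches `n ≤ ℓ ^ 10`; this is why the
    -- induction stops at 21.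
    have hm := sum_degree_le_of_egirth G₀ (t := ℓ + 1) (k := 10)
      (lt_of_lt_of_le (by exact_mod_cast (by norm_num : 2 * 10 < 21)) hg) (by
        rw [Fintype.card_fin]
        exact hℓ.trans_lt (Nat.pow_lt_pow_left (Nat.lt_succ_self ℓ) (by norm_num)))
    simp only [hG₀ _, Fintype.card_fin] at hm
    refine (Solves.of_sum_degree_le (d := d) hB (fun G hG => hG.1) (L := 2 * ℓ + 3)
      ?_).mono_rounds (by omega)
    nlinarith
  | succ j ih =>
    obtain ⟨C, hC⟩ := ih (p + 1) (by omega) (by omega)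
    refine ⟨12 * 4 ^ p + 10 + (6 * p + 1) * 12 ^ p + C, fun n B ℓ hn hB hℓ d => ?_⟩
    have hℓ0 : 0 < ℓ := by
      by_contra h0
      obtain rfl : ℓ = 0 := by omega
      simp at hℓ
      omega
    obtain ⟨Q, hQ, hnQ, hQn⟩ := exists_prime_pow_between hn p (by omega)
    obtain ⟨k, rfl⟩ : ∃ k, p = k + 4 := ⟨p - 4, by omega⟩
    rcases le_or_gt (∑ v, d v) (4 * Q ^ 2 * n * ℓ) with hd | hd
    · rw [Nat.add_mul]
      refine Solves.detect (d := d) rfl (by omega) hB (fun G hG => hG.1) (fun G hG => hG.2) hQ hnQ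
        hQn hℓ0 hd ((hC n B ℓ hn hB hℓ d).mono (fun G hG => ⟨hG.1.1, hG.2⟩) fun _ _ _ _ _ h => h)
    · refine Solves.of_const ((k + 4 : ℕ) : ℕ∞) fun G hG => le_antisymm ?_ hG.2
      by_contra hlt
      have hlt : ((k + 4 : ℕ) : ℕ∞) < G.egirth := not_le.1 hlt
      have hle : 2 * ((k + 4) / 2) ≤ k + 4 := by omega
      -- The factor `2` in `t` makes the inequality `n < t ^ k` strict.
      have hm := sum_degree_le_of_egirth G (t := 2 * (Q ^ 2 * ℓ)) (k := (k + 4) / 2)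
        (lt_of_le_of_lt (by exact_mod_cast hle) hlt) (by
          rw [Fintype.card_fin, mul_pow]
          have h1 := le_pow_mul_pow (by omega) hQ.pos hℓ0 hnQ hℓ
          have h2 : 2 ≤ 2 ^ ((k + 4) / 2) := Nat.le_self_pow (by omega) 2
          nlinarith)
      simp only [hG.1 _, Fintype.card_fin] at hm
      have h3 : 2 * (2 * (Q ^ 2 * ℓ)) * n = 4 * Q ^ 2 * n * ℓ := by ring
      omega

end Assembly

end CongestedClique

theorem corollary4 :
    ∃ (b : ℕ) (A : ∀ n : ℕ, CongestedClique.Algorithm n (b * Nat.clog 2 n) ℕ∞) (T : ℕ → ℕ),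
      CongestedClique.IsSoftO T (fun n => (n : ℝ) ^ (1 / 10 : ℝ)) ∧
      ∀ (n : ℕ) (G : SimpleGraph (Fin n)), G.CliqueFree 3 →
        (A n).OutputsWithin G (T n) G.egirth := by
  open CongestedClique in
  obtain ⟨C, hC⟩ := exists_rounds_of_le_egirth 17 4 le_rfl rfl
  let ℓ : ℕ → ℕ := fun n => ⌈(n : ℝ) ^ (1 / 10 : ℝ)⌉₊
  let T : ℕ → ℕ := fun n => 1 + C * ℓ n
  have hsolve : ∀ n : ℕ, Solves (3 * Nat.clog 2 n) SimpleGraph.egirth (T n)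
      {G : SimpleGraph (Fin n) | G.CliqueFree 3} localView := by
    intro n
    rcases lt_or_ge n 2 with hn | hn
    · have : Subsingleton (Fin n) := Fin.subsingleton_iff_le_one.2 (by omega)
      exact Solves.of_const (SimpleGraph.egirth (⊥ : SimpleGraph (Fin n))) fun G _ =>
        congrArg _ (Subsingleton.elim _ _)
    -- Messages carry edge codes below `n ^ 2` and counts that may equal `n ^ 2`, so the strict
    -- bound is needed and `2 * Nat.clog 2 n` bits might fall just short.
    have hB : n ^ 2 < 2 ^ (3 * Nat.clog 2 n) := by
      calc n ^ 2 < n ^ 3 := Nat.pow_lt_pow_right (by omega) (by norm_num)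
        _ ≤ (2 ^ Nat.clog 2 n) ^ 3 := Nat.pow_le_pow_left (Nat.le_pow_clog one_lt_two n) 3
        _ = _ := by rw [← pow_mul, mul_comm]
    have hℓ : n ≤ ℓ n ^ 10 := by
      have h1 : ((n : ℝ) ^ (1 / 10 : ℝ)) ^ 10 = n := by
        rw [← Real.rpow_natCast, ← Real.rpow_mul (Nat.cast_nonneg n)]
        norm_num
      have h2 : (n : ℝ) ≤ (ℓ n : ℝ) ^ 10 := by
        rw [← h1]
        exact pow_le_pow_left₀ (by positivity) (Nat.le_ceil _) 10
      exact_mod_cast h2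
    exact Solves.of_degreeClass hB fun d => (hC n _ (ℓ n) hn hB hℓ d).mono
      (fun G hG => ⟨hG.2, by exact_mod_cast four_le_egirth_of_cliqueFree hG.1⟩)
      fun _ _ _ _ _ h => h
  choose A hA using fun n => (hsolve n).exists_algorithm
  -- The logarithmic exponent is `0`: no logarithmic factor is lost.
  refine ⟨3, A, T, ⟨0, ?_⟩, fun n G hG v => ⟨T n, le_rfl, hA n G hG v⟩⟩
  refine IsBigO.of_bound (1 + 2 * C) (eventually_atTop.2 ⟨1, fun n hn => ?_⟩)
  have h1 : (1 : ℝ) ≤ (n : ℝ) ^ (1 / 10 : ℝ) :=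
    Real.one_le_rpow (by exact_mod_cast hn) (by norm_num)
  have h2 : (ℓ n : ℝ) ≤ 2 * (n : ℝ) ^ (1 / 10 : ℝ) := by
    have := (Nat.ceil_lt_add_one (by positivity : (0 : ℝ) ≤ (n : ℝ) ^ (1 / 10 : ℝ))).le
    linarith
  have h3 : (C : ℝ) * ℓ n ≤ C * (2 * (n : ℝ) ^ (1 / 10 : ℝ)) :=
    mul_le_mul_of_nonneg_left h2 (Nat.cast_nonneg C)
  simp only [T, pow_zero, mul_one]
  rw [Real.norm_of_nonneg (by positivity), Real.norm_of_nonneg (by positivity)]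
  push_cast
  linarith
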